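/- Let $p$ be an odd prime, let $k$ be an algebraically closed field of characteristic $p$, and let $G$ be a finite group. Let $\mathbf{B}$ be a block of $kG$ with a defect group $D$ that is cyclic of order $p^a$ with $a\ge 1$ and normal in $G$. Let $u\in D$ have order $p$; for $g\in G$ write $gug^{-1}=u^{n(g)}$ and let $\lambda:G\to k^\times$ be the linear character $\lambda(g)=n(g)1_k$. Let $S$ be an irreducible $\mathbf{B}$-module with $S^*\cong\lambda S$, and let $M$ be a uniserial $kG$-module of composition length $2$ with head $S$ and socle $\lambda S$, i.e. $M$ is uniserial and there is a short exact sequence $0\to\lambda S\to M\to S\to 0$. Fix an embedding of the group of roots of unity of $k$ into $\mathbb{C}^\times$, with respect to which Brauer characters are formed, and let $\chi$ and $\mu$ be irreducible complex characters of $G$ whose restrictions to the $p$-regular elements of $G$ are the Brauer characters of $S$ and of $\lambda$, respectively. Put $$\epsilon_\mu(\chi)=\frac{1}{|G|}\sum_{g\in G}\mu(g)\chi(g^2).$$ Then $M$ is a self-dual indecomposable $\mathbf{B}$-module. Moreover, if $\epsilon_\mu(\chi)=-1$ then $M$ has orthogonal type (it affords a non-degenerate $G$-invariant quadratic form), and if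 $\epsilon_\mu(\chi)=+1$ then $M$ has symplectic type (it affords a non-degenerate $G$-invariant alternating bilinear form). -/

import Mathlib

/-! ## Modular representations: twists, duals, uniserial modules -/

section Modules

variable {k G V : Type*} [Field k] [Group G] [AddCommGroup V] [Module k V]

/-- The twist `λS` of a representation `S` by a linear character `λ`: the element `g` acts as
`λ(g) · ρ(g)`. -/
def twistRep (lam : G →* kˣ) (ρ : Representation k G V) : Representation k G V where
  toFun g := (lam g : k) • ρ g
  map_one' := by simp
  map_mul' g h := by
    ext v
    simp [mul_smul, smul_comm (lam g : k) (lam h : k)]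

/-- The one-dimensional representation of `G` on `k` given by the linear character `λ`. -/
def linearRep (lam : G →* kˣ) : Representation k G k :=
  twistRep lam (Representation.trivial k G k)

/-- `M ≅ M^*` as `kG`-modules. -/
def IsSelfDual (ρ : Representation k G V) : Prop :=
  Nonempty (ρ.Equiv ρ.dual)

/-- `M` is non-zero and is not the direct sum of two non-zero submodules. -/
def IsIndecomposableRep (ρ : Representation k G V) : Prop :=
  Nontrivial V ∧ ∀ X Y : Subrepresentation ρ, IsCompl X Y → X = ⊥ ∨ Y = ⊥

/-- The submodules of `M` form a chain. -/
def IsUniserialRep (ρ : Representation k G V) : Prop :=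
  ∀ X Y : Subrepresentation ρ, X ≤ Y ∨ Y ≤ X

/-- `M` is uniserial and there is a short exact sequence `0 → T → M → S → 0` of `kG`-modules.
For irreducible `S` and `T` this says that `M` is uniserial of composition length two, with
head `S` and socle `T`. -/
structure IsUniserialOfHeadSocle {W U : Type*} [AddCommGroup W] [Module k W]
    [AddCommGroup U] [Module k U] (M : Representation k G V) (S : Representation k G W)
    (T : Representation k G U) : Prop where
  uniserial : IsUniserialRep M
  exact_seq : ∃ (i : Representation.IntertwiningMap T M) (q : Representation.IntertwiningMap M S),
    Function.Injective i ∧ Function.Surjective q ∧ Function.Exact i q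

/-- `M` affords a non-degenerate `G`-invariant quadratic form. -/
def IsOrthogonalType (ρ : Representation k G V) : Prop :=
  ∃ Q : QuadraticForm k V, Q.Nondegenerate ∧ ∀ g v, Q (ρ g v) = Q v

/-- `M` affords a non-degenerate `G`-invariant alternating bilinear form. -/
def IsSymplecticType (ρ : Representation k G V) : Prop :=
  ∃ B : LinearMap.BilinForm k V, B.Nondegenerate ∧ B.IsAlt ∧
    ∀ g v w, B (ρ g v) (ρ g w) = B v w

end Modules

/-! ## Blocks and defect groups -/

section Blocks

variable {k G : Type*} [Field k] [Group G]

/-- `b` is a block idempotent of `kG`, i.e. a primitive idempotent of the centre of `kG`. The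
corresponding block is the minimal (direct factor) two-sided ideal `kG b`. -/
def IsBlockIdempotent (b : MonoidAlgebra k G) : Prop :=
  b ∈ Subalgebra.center k (MonoidAlgebra k G) ∧ b * b = b ∧ b ≠ 0 ∧
    ∀ c ∈ Subalgebra.center k (MonoidAlgebra k G), c * c = c → c * b = c → c = 0 ∨ c = b

/-- The module `M` belongs to the block with idempotent `b`, i.e. `b` acts on it as the
identity. -/
def BelongsToBlock {V : Type*} [AddCommGroup V] [Module k V] (ρ : Representation k G V)
    (b : MonoidAlgebra k G) : Prop :=
  ρ.asAlgebraHom b = 1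

/-- The relative trace `Tr_H^G(a) = ∑_{g ∈ G/H} g a g⁻¹`; it does not depend on the choice of
coset representatives when `a` is fixed by conjugation with elements of `H`. -/
noncomputable def relTrace (H : Subgroup G) (a : MonoidAlgebra k G) : MonoidAlgebra k G :=
  ∑ᶠ t : G ⧸ H, MonoidAlgebra.of k G t.out * a * MonoidAlgebra.of k G t.out⁻¹

/-- `b` lies in the image of `Tr_H^G` on the `H`-fixed points `(kG)^H`. -/
def IsRelTraceFrom (b : MonoidAlgebra k G) (H : Subgroup G) : Prop :=
  ∃ a : MonoidAlgebra k G,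
    (∀ h ∈ H, MonoidAlgebra.of k G h * a * MonoidAlgebra.of k G h⁻¹ = a) ∧ relTrace H a = b

/-- `D` is a defect group of the block with idempotent `b`: a minimal subgroup with
`b ∈ Tr_D^G((kG)^D)`. -/
def IsDefectGroup (b : MonoidAlgebra k G) (D : Subgroup G) : Prop :=
  IsRelTraceFrom b D ∧ ∀ E : Subgroup G, E < D → ¬ IsRelTraceFrom b E

end Blocks

/-! ## The linear character given by the action on the subgroup of order `p` -/

section ActionCharacter

variable {G : Type*} [Group G]

theorem exists_conj_eq_pow [Finite G] (D : Subgroup G) [hD : D.Normal] [hc : IsCyclic D]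
    {u : G} (hu : u ∈ D) (g : G) : ∃ n : ℕ, g * u * g⁻¹ = u ^ n := by
  obtain ⟨d, hd⟩ := hc.exists_generator
  obtain ⟨m, hm⟩ := Subgroup.mem_zpowers_iff.1 (hd ⟨g * d * g⁻¹, hD.conj_mem d d.2 g⟩)
  obtain ⟨j, hj⟩ := Subgroup.mem_zpowers_iff.1 (hd ⟨u, hu⟩)
  have hm' : (d : G) ^ m = g * d * g⁻¹ := by simpa using congrArg Subtype.val hm
  have hj' : (d : G) ^ j = u := by simpa using congrArg Subtype.val hj
  have h : g * u * g⁻¹ ∈ Submonoid.powers u := by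
    rw [mem_powers_iff_mem_zpowers]
    refine Subgroup.mem_zpowers_iff.2 ⟨m, ?_⟩
    rw [← hj', ← conj_zpow, ← hm', ← zpow_mul, ← zpow_mul, mul_comm]
  obtain ⟨n, hn⟩ := h
  exact ⟨n, hn.symm⟩

variable (k : Type*) [Field k] (p : ℕ) [CharP k p]

theorem natCast_eq_of_pow_eq {u : G} (hu : orderOf u = p) {m n : ℕ} (h : u ^ m = u ^ n) :
    (m : k) = n := by
  rw [CharP.natCast_eq_natCast k p, ← hu]
  exact pow_eq_pow_iff_modEq.1 h

/-- For a cyclic normal subgroup `D` and `u ∈ D` of order `p`, the linear character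
`λ : G → kˣ`, `λ(g) = n(g) 1_k`, where `g u g⁻¹ = u ^ n(g)`. -/
noncomputable def actionCharacter [Finite G] (D : Subgroup G) [D.Normal] [IsCyclic D]
    (u : G) (huD : u ∈ D) (hu : orderOf u = p) : G →* kˣ :=
  MonoidHom.toHomUnits
    { toFun := fun g => ((exists_conj_eq_pow D huD g).choose : k)
      map_one' := by
        rw [← Nat.cast_one]
        refine natCast_eq_of_pow_eq k p hu ?_
        rw [← (exists_conj_eq_pow D huD 1).choose_spec]
        simp
      map_mul' := fun g h => by
        rw [← Nat.cast_mul]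
        refine natCast_eq_of_pow_eq k p hu ?_
        rw [← (exists_conj_eq_pow D huD (g * h)).choose_spec, pow_mul,
          ← (exists_conj_eq_pow D huD g).choose_spec, conj_pow,
          ← (exists_conj_eq_pow D huD h).choose_spec]
        group }

theorem actionCharacter_eq [Finite G] (D : Subgroup G) [D.Normal] [IsCyclic D]
    (u : G) (huD : u ∈ D) (hu : orderOf u = p) (g : G) (n : ℕ) (h : g * u * g⁻¹ = u ^ n) :
    (actionCharacter k p D u huD hu g : k) = n := by
  refine natCast_eq_of_pow_eq k p hu ?_
  rw [← (exists_conj_eq_pow D huD g).choose_spec, h]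

end ActionCharacter

/-! ## Brauer characters, ordinary characters, and the twisted indicator -/

section Characters

open Classical in
/-- The Brauer character of a representation with respect to an identification `θ` of the
roots of unity of `k` with complex roots of unity: the value at a `p`-regular element `g` is
the sum of the lifts of the eigenvalues of `g`, with multiplicities. (All eigenvalues of an
element of finite order are roots of unity; the value `0` elsewhere plays no role.) -/
noncomputable def brauerCharacter {k G V : Type*} [Field k] [Group G] [AddCommGroup V]
    [Module k V] [FiniteDimensional k V] (θ : CommGroup.torsion kˣ →* ℂˣ)
    (ρ : Representation k G V) (g : G) : ℂ :=
  ((ρ g).charpoly.roots.map fun x : k =>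
    if h : ∃ z : CommGroup.torsion kˣ, ((z : kˣ) : k) = x then ((θ h.choose : ℂˣ) : ℂ)
    else 0).sum

/-- `χ` is the character of an irreducible complex representation of `G`. -/
def IsIrreducibleCharacter {G : Type*} [Group G] (χ : G → ℂ) : Prop :=
  ∃ (n : ℕ) (X : Representation ℂ G (Fin n → ℂ)), X.IsIrreducible ∧ X.character = χ

/-- The ordinary function `χ` lifts the Brauer character `φ`: they agree on the elements of
order prime to `p`. -/
def LiftsBrauer {G : Type*} [Group G] (p : ℕ) (χ φ : G → ℂ) : Prop :=
  ∀ g : G, (orderOf g).Coprime p → χ g = φ g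

/-- `ε_μ(χ) = (1/|G|) ∑_{g ∈ G} μ(g) χ(g²)`. -/
noncomputable def twistedIndicator {G : Type*} [Group G] [Fintype G] (μ χ : G → ℂ) : ℂ :=
  (1 / (Fintype.card G : ℂ)) * ∑ g : G, μ g * χ (g ^ 2)

end Characters

/-!
The sign of an invariant form on `M` is opposite to the sign of the `λ⁻¹`-valued form on `S`, and the
sign of the latter is the twisted indicator of `χ`.

*Forms on `M`.* An isomorphism `S^* ≅ λS` is a non-degenerate form `ψ` on `S` with
`ψ(gv, gw) = λ(g)⁻¹ ψ(v, w)`, and Schur's lemma gives it a sign `δ = ±1` (`exists_twisted_form`). The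
group `D` acts trivially on `S` and on `λS`, and if `d` generates `D` then `d - 1` acts on `M` as a
scalar multiple of `M → S = λS → M` (`exists_apply_generator_pow_eq`). Hence, for a linear retraction
`r` of `i : λS → M`, the form `ψ(r m, q m') - ψ(q m, r m')` on `M` is `D`-invariant. The block
idempotent is a relative trace `Tr_D^G(a)` and acts on `M` as the identity, so the average
`∑_{t ∈ G/D} t a f t⁻¹` of this form `f` is `G`-invariant and agrees with `f` on pairs with one entry
in the socle (`relAverage_isIntertwining`, `relAverage_comp`, `comp_relAverage`). Its part of sign `-δ`
is non-degenerate (`exists_invariant_form_of_extension`).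

*The sign of `ψ`.* If the twisted indicator of `χ` is `ε = ±1`, then a representation `X` affording
`χ` has a `μ⁻¹`-valued invariant form of sign `ε` (`exists_invariant_form_of_indicator`). To compare
`ε` with `δ`, consider the matrix with entries `χ(hg) - ε μ(g)⁻¹ χ(hg⁻¹)`. Its rows represent
`A - ε A*` for `A = X(g)` and its adjoint `A*`, and these correspond to skew-symmetric matrices, so
that the rank is at most `n(n-1)/2` for `n = χ(1)` (`rank_adjointTraceMatrix_le`). If `δ = -ε`, then
the same matrix formed with the traces of `S` in characteristic `p` has rank at least `n(n+1)/2`,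
since the operators of `S` span all endomorphisms (`card_le_rank_adjointTraceMatrix`). But the values
of `χ` and `μ` reduce to the traces of `S` and to `λ` (`character_trace_mem`), and reduction does not
raise the rank (`Matrix.rank_le_rank_of_mem_subring`). Hence `δ = ε`.
-/

/-! ### Traces of powers -/

/-- The eigenvalues `x` of an endomorphism and the dimensions `d x` of its generalized eigenspaces
compute the traces of all its powers. -/
theorem Module.End.exists_trace_pow_eq_sum {K V : Type*} [Field K] [IsAlgClosed K]
    [AddCommGroup V] [Module K V] [FiniteDimensional K V] (f : Module.End K V) :
    ∃ (s : Finset K) (d : K → ℕ), (∀ x ∈ s, f.HasEigenvalue x) ∧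
      ∀ j : ℕ, LinearMap.trace K V (f ^ j) = ∑ x ∈ s, (d x : K) * x ^ j := by
  classical
  have hds : DirectSum.IsInternal f.maxGenEigenspace :=
    DirectSum.isInternal_submodule_of_iSupIndep_of_iSup_eq_top f.independent_maxGenEigenspace
      f.iSup_maxGenEigenspace_eq_top
  have hfin : {x | f.maxGenEigenspace x ≠ ⊥}.Finite :=
    WellFoundedGT.finite_ne_bot_of_iSupIndep f.independent_maxGenEigenspace
  refine ⟨hfin.toFinset, fun x => Module.finrank K (f.maxGenEigenspace x), fun x hx => ?_,
    fun j => ?_⟩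
  · have hx' : f.maxGenEigenspace x ≠ ⊥ := by simpa using hx
    rw [Module.End.hasEigenvalue_iff]
    intro h
    apply hx'
    rw [Module.End.maxGenEigenspace_eq_genEigenspace_finrank]
    by_contra h0
    exact (Module.End.hasEigenvalue_of_hasGenEigenvalue (f := f) (k := Module.finrank K V)
      (μ := x) h0) h
  · have hmaps : ∀ (i : ℕ) (x : K), Set.MapsTo (f ^ i) (f.maxGenEigenspace x)
        (f.maxGenEigenspace x) := fun i x =>
      Module.End.mapsTo_maxGenEigenspace_of_comm ((Commute.refl f).pow_right i) x
    rw [LinearMap.trace_eq_sum_trace_restrict' hds hfin (hmaps j)]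
    refine Finset.sum_congr rfl fun x _ => ?_
    have h1 : Set.MapsTo f (f.maxGenEigenspace x) (f.maxGenEigenspace x) := by
      simpa using hmaps 1 x
    set E := f.maxGenEigenspace x
    set g : Module.End K E := f.restrict h1
    have hg : (f ^ j).restrict (hmaps j x) = g ^ j :=
      (Module.End.pow_restrict j h1 (hmaps j x)).symm
    have hnil : IsNilpotent (g - algebraMap K (Module.End K E) x) := by
      have := f.isNilpotent_restrict_maxGenEigenspace_sub_algebraMap x
      convert this using 1
      ext
      rfl
    have hc : Commute g (algebraMap K (Module.End K E) x) := Algebra.commute_algebraMap_right x g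
    have hnilj : IsNilpotent (g ^ j - algebraMap K (Module.End K E) x ^ j) := by
      rw [← hc.geom_sum₂_mul]
      refine Commute.isNilpotent_mul_left ?_ hnil
      refine (Commute.sum_left _ _ _ fun i _ => ?_)
      exact (((Commute.refl g).sub_right hc).pow_left i).mul_left
        ((hc.symm.sub_right (Commute.refl _)).pow_left _)
    have htr := (LinearMap.isNilpotent_trace_of_isNilpotent hnilj).eq_zero
    rw [map_sub, sub_eq_zero] at htr
    change LinearMap.trace K E _ = _
    rw [hg, htr, ← map_pow,
      Algebra.algebraMap_eq_smul_one, map_smul, LinearMap.trace_one, smul_eq_mul, mul_comm]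

theorem Module.End.HasEigenvalue.pow_eq_one {K V : Type*} [Field K] [AddCommGroup V]
    [Module K V] {f : Module.End K V} {x : K} (hx : f.HasEigenvalue x) {N : ℕ} (hf : f ^ N = 1) :
    x ^ N = 1 := by
  obtain ⟨v, hv⟩ := hx.exists_hasEigenvector
  have h := hv.pow_apply N
  rw [hf, Module.End.one_apply] at h
  have h' : (x ^ N - 1) • v = 0 := by rw [sub_smul, ← h, one_smul, sub_self]
  exact sub_eq_zero.1 ((smul_eq_zero.1 h').resolve_right hv.2)

/-! ### Reduction of cyclotomic integers -/

/-- In characteristic `p` every `N`-th root of unity has order prime to `p`, so a suitable power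
map fixes all of them while it takes each group element of order dividing `N` to its
`p`-regular part. -/
theorem exists_pRegular_exponent (k : Type*) [Field k] (p : ℕ) [Fact p.Prime] [CharP k p]
    {N : ℕ} (hN : N ≠ 0) :
    ∃ j : ℕ, (∀ x : k, x ^ N = 1 → x ^ j = x) ∧
      ∀ {G : Type*} [Group G] (g : G), g ^ N = 1 → (orderOf (g ^ j)).Coprime p := by
  obtain ⟨c, m, hpm, rfl⟩ := Nat.exists_eq_pow_mul_and_not_dvd hN p (Fact.out : p.Prime).ne_one
  have hp : p.Prime := Fact.out
  have hcop : (p ^ c).Coprime m := (hp.coprime_iff_not_dvd.2 hpm).pow_left c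
  obtain ⟨j, hj0, hj1⟩ := Nat.chineseRemainder hcop 0 1
  refine ⟨j, fun x hx => ?_, fun g hg => ?_⟩
  · have hxm : x ^ m = 1 := by
      rw [mul_comm, pow_mul] at hx
      have h : ((x ^ m - 1) ^ p ^ c) = 0 := by
        rw [sub_pow_char_pow, hx, one_pow, sub_self]
      exact sub_eq_zero.1 (pow_eq_zero_iff (pow_ne_zero _ hp.ne_zero) |>.1 h)
    conv_rhs => rw [← pow_one x]
    exact pow_eq_pow_of_modEq hj1 hxm
  · obtain ⟨t, ht⟩ := (Nat.modEq_zero_iff_dvd).1 hj0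
    refine Nat.Coprime.of_dvd_left (orderOf_dvd_of_pow_eq_one (n := m) ?_)
      (hp.coprime_iff_not_dvd.2 hpm).symm
    rw [← pow_mul, ht, mul_right_comm, pow_mul, hg, one_pow]

/-- Reduction modulo a prime above `p`, compatible with the identification `θ` of roots of
unity, as a subring of `ℂ × k`: the pairs `(x, y)` for which the algebraic integer `x` reduces
to `y`. The first property says that `y` is determined by `x`. -/
theorem exists_reduction_subring {k : Type*} [Field k] [IsAlgClosed k] (p : ℕ) [Fact p.Prime]
    [CharP k p] (θ : CommGroup.torsion kˣ →* ℂˣ) (hθ : Function.Injective θ) (N : ℕ)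
    (hN : N ≠ 0) :
    ∃ T : Subring (ℂ × k), (∀ y, ((0 : ℂ), y) ∈ T → y = 0) ∧
      (∀ x : ℂ, x ^ N = 1 → ∃ y : k, y ^ N = 1 ∧ (x, y) ∈ T) ∧
      (∀ z : CommGroup.torsion kˣ, ((z : kˣ) : k) ^ N = 1 →
        (((θ z : ℂˣ) : ℂ), ((z : kˣ) : k)) ∈ T) := by
  obtain ⟨c, m, hpm, rfl⟩ := Nat.exists_eq_pow_mul_and_not_dvd hN p (Fact.out : p.Prime).ne_one
  have hp : p.Prime := Fact.out
  have hm0 : m ≠ 0 := by rintro rfl; simp at hpm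
  have hmk : NeZero (m : k) := ⟨fun h => hpm ((CharP.cast_eq_zero_iff k p m).1 h)⟩
  have : NeZero m := ⟨hm0⟩
  obtain ⟨z, hz⟩ := HasEnoughRootsOfUnity.exists_primitiveRoot k m
  -- `z` as a torsion unit
  have hzu : IsOfFinOrder (hz.isUnit hm0).unit := by
    rw [isOfFinOrder_iff_pow_eq_one]
    exact ⟨m, Nat.pos_of_ne_zero hm0, Units.ext (by simpa using hz.pow_eq_one)⟩
  let t : CommGroup.torsion kˣ := ⟨(hz.isUnit hm0).unit, hzu⟩
  have htz : ((t : kˣ) : k) = z := rfl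
  have ht : IsPrimitiveRoot t m := by
    have h1 : IsPrimitiveRoot ((t : kˣ) : k) m := hz
    exact (IsPrimitiveRoot.coe_units_iff.1 h1).of_map_of_injective
      (f := (CommGroup.torsion kˣ).subtype) Subtype.val_injective
  have htC : IsPrimitiveRoot ((θ t : ℂˣ) : ℂ) m :=
    IsPrimitiveRoot.coe_units_iff.2 (ht.map_of_injective hθ)
  have hξ : IsPrimitiveRoot (Complex.exp (2 * Real.pi * Complex.I / (p ^ c : ℕ))) (p ^ c) :=
    Complex.isPrimitiveRoot_exp _ (pow_ne_zero _ hp.ne_zero)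
  set ξ := Complex.exp (2 * Real.pi * Complex.I / (p ^ c : ℕ))
  have hcop : (p ^ c).Coprime m := (hp.coprime_iff_not_dvd.2 hpm).pow_left c
  -- The product of primitive roots of coprime orders is a primitive root, and it reduces to `z`.
  set w : ℂ := ξ * ((θ t : ℂˣ) : ℂ)
  have hw : IsPrimitiveRoot w (p ^ c * m) := by
    rw [hξ.eq_orderOf, htC.eq_orderOf] at hcop ⊢
    rw [← (Commute.all _ _).orderOf_mul_eq_mul_orderOf_of_coprime hcop]
    exact IsPrimitiveRoot.orderOf _
  have hroot : (Polynomial.cyclotomic (p ^ c * m) k).IsRoot z :=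
    Polynomial.isRoot_cyclotomic_prime_pow_mul_iff_of_charP.2 hz
  let ev : Polynomial ℤ →+* ℂ × k := (Polynomial.aeval (w, z)).toRingHom
  have hev : ∀ P, ev P = (Polynomial.aeval w P, Polynomial.aeval z P) := fun P => by
    change Polynomial.aeval (w, z) P = _
    exact Polynomial.aeval_prod_apply ..
  refine ⟨ev.range, ?_, ?_, ?_⟩
  · rintro y ⟨P, hP⟩
    rw [hev, Prod.mk.injEq] at hP
    have hdvd : Polynomial.cyclotomic (p ^ c * m) ℤ ∣ P := by
      rw [Polynomial.cyclotomic_eq_minpoly hw (Nat.pos_of_ne_zero hN)]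
      exact minpoly.isIntegrallyClosed_dvd (hw.isIntegral (Nat.pos_of_ne_zero hN)) hP.1
    obtain ⟨Q, rfl⟩ := hdvd
    rw [← hP.2, map_mul, Polynomial.aeval_def, Polynomial.eval₂_eq_eval_map,
      Polynomial.map_cyclotomic, hroot.eq_zero, zero_mul]
  · intro x hx
    have : NeZero (p ^ c * m) := ⟨hN⟩
    obtain ⟨i, -, rfl⟩ := hw.eq_pow_of_pow_eq_one hx
    refine ⟨z ^ i, ?_, Polynomial.X ^ i, by rw [hev]; simp⟩
    rw [← pow_mul, mul_left_comm, mul_comm, mul_comm i, mul_assoc, pow_mul, hz.pow_eq_one, one_pow]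
  · intro y hy
    have hym : ((y : kˣ) : k) ^ m = 1 := by
      rw [mul_comm, pow_mul] at hy
      have h : ((((y : kˣ) : k) ^ m - 1) ^ p ^ c) = 0 := by
        rw [sub_pow_char_pow, hy, one_pow, sub_self]
      exact sub_eq_zero.1 (pow_eq_zero_iff (pow_ne_zero _ hp.ne_zero) |>.1 h)
    obtain ⟨i, -, hi⟩ := hz.eq_pow_of_pow_eq_one hym
    have hyt : y = t ^ i := by
      apply Subtype.ext
      apply Units.ext
      rw [← hi]
      simp [htz]
    -- an exponent that kills `ξ` and fixes `θ t`
    obtain ⟨j, hj0, hj1⟩ := Nat.chineseRemainder hcop 0 1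
    refine ⟨Polynomial.X ^ (j * i), ?_⟩
    have hξj : ξ ^ j = 1 := by
      rw [hξ.pow_eq_one_iff_dvd]; exact (Nat.modEq_zero_iff_dvd).1 hj0
    have htj : ((θ t : ℂˣ) : ℂ) ^ j = (θ t : ℂˣ) := by
      conv_rhs => rw [← pow_one ((θ t : ℂˣ) : ℂ)]
      exact pow_eq_pow_of_modEq hj1 htC.pow_eq_one
    have hzj : z ^ j = z := by
      conv_rhs => rw [← pow_one z]
      exact pow_eq_pow_of_modEq hj1 hz.pow_eq_one
    have hwj : w ^ j = (θ t : ℂˣ) := by rw [mul_pow, hξj, htj, one_mul]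
    rw [hev, hyt, map_pow, map_pow, Polynomial.aeval_X, Polynomial.aeval_X, pow_mul, pow_mul, hwj,
      hzj, map_pow]
    rfl

theorem Representation.pow_eq_one_of_pow_eq_one {K G V : Type*} [Field K] [Group G]
    [AddCommGroup V] [Module K V] (ρ : Representation K G V) {g : G} {N : ℕ} (hg : g ^ N = 1) :
    ρ g ^ N = 1 := by
  rw [← map_pow, hg, map_one]

/-- An ordinary character that lifts a Brauer character reduces to the trace at every group
element: both sides take the same value at `g` and at its `p`-regular part. -/
theorem character_trace_mem {k : Type*} [Field k] [IsAlgClosed k] (p : ℕ) [Fact p.Prime]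
    [CharP k p] {G : Type*} [Group G] [Fintype G] (θ : CommGroup.torsion kˣ →* ℂˣ)
    {T : Subring (ℂ × k)} (hT0 : ∀ y, ((0 : ℂ), y) ∈ T → y = 0)
    (hT1 : ∀ x : ℂ, x ^ Fintype.card G = 1 → ∃ y : k, y ^ Fintype.card G = 1 ∧ (x, y) ∈ T)
    (hTθ : ∀ z : CommGroup.torsion kˣ, ((z : kˣ) : k) ^ Fintype.card G = 1 →
        (((θ z : ℂˣ) : ℂ), ((z : kˣ) : k)) ∈ T)
    {V W : Type*} [AddCommGroup V] [Module ℂ V] [FiniteDimensional ℂ V] [AddCommGroup W]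
    [Module k W] [FiniteDimensional k W] (X : Representation ℂ G V) (S : Representation k G W)
    (h : LiftsBrauer p X.character (brauerCharacter θ S)) (g : G) :
    (X.character g, LinearMap.trace k W (S g)) ∈ T := by
  classical
  set N := Fintype.card G
  have hN : N ≠ 0 := Fintype.card_ne_zero
  have hgN : ∀ g : G, g ^ N = 1 := fun g => pow_card_eq_one
  obtain ⟨j, hj, hreg⟩ := exists_pRegular_exponent k p hN
  -- reduction of a Brauer character value
  have hB : ∀ g : G, (brauerCharacter θ S g, LinearMap.trace k W (S g)) ∈ T := by
    intro g
    rw [brauerCharacter, Module.End.trace_eq_sum_roots_charpoly_of_splits (IsAlgClosed.splits _)]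
    have hr : ∀ x ∈ (S g).charpoly.roots, x ^ N = 1 := fun x hx =>
      Module.End.HasEigenvalue.pow_eq_one
        ((Module.End.hasEigenvalue_iff_isRoot_charpoly _ _).2 (Polynomial.isRoot_of_mem_roots hx))
        (S.pow_eq_one_of_pow_eq_one (hgN g))
    generalize (S g).charpoly.roots = r at hr ⊢
    induction r using Multiset.induction with
    | empty => exact T.zero_mem
    | cons x r ih =>
      have hx := hr x (Multiset.mem_cons_self x r)
      have hex : ∃ z : CommGroup.torsion kˣ, ((z : kˣ) : k) = x := by
        have hu : IsUnit x := IsUnit.of_pow_eq_one hx hN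
        refine ⟨⟨hu.unit, ?_⟩, rfl⟩
        exact isOfFinOrder_iff_pow_eq_one.2
          ⟨N, Nat.pos_of_ne_zero hN, Units.ext (by simpa using hx)⟩
      have hθx := hTθ hex.choose (by rw [hex.choose_spec]; exact hx)
      rw [hex.choose_spec] at hθx
      rw [Multiset.map_cons, Multiset.sum_cons, Multiset.sum_cons, dif_pos hex]
      exact T.add_mem hθx (ih fun y hy => hr y (Multiset.mem_cons_of_mem hy))
  have hcast : ∀ n : ℕ, ((n : ℂ), (n : k)) ∈ T := fun n =>
    natCast_mem T n
  -- `X` at `g` and at the `p`-regular part of `g`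
  obtain ⟨s, d, hs, htr⟩ := Module.End.exists_trace_pow_eq_sum (X g)
  choose! π hπ1 hπT using hT1
  have hs1 : ∀ x ∈ s, x ^ N = 1 := fun x hx =>
    (hs x hx).pow_eq_one (X.pow_eq_one_of_pow_eq_one (hgN g))
  have hpow : ∀ i : ℕ, (X.character (g ^ i), ∑ x ∈ s, (d x : k) * π x ^ i) ∈ T := fun i => by
    have h1 : X.character (g ^ i) = ∑ x ∈ s, (d x : ℂ) * x ^ i := by
      rw [← htr, ← map_pow]; rfl
    have h2 := T.sum_mem (t := s) (f := fun x => ((d x : ℂ), (d x : k)) * (x, π x) ^ i)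
      fun x hx => T.mul_mem (hcast _) (T.pow_mem (hπT x (hs1 x hx)) i)
    rw [h1]
    convert h2 using 1
    ext
    · simp [Prod.fst_sum]
    · simp [Prod.snd_sum]
  have h1 := hpow 1
  have hjm := hpow j
  have hsum : ∑ x ∈ s, (d x : k) * π x ^ j = ∑ x ∈ s, (d x : k) * π x ^ 1 :=
    Finset.sum_congr rfl fun x hx => by rw [hj _ (hπ1 x (hs1 x hx)), pow_one]
  rw [hsum, h _ (hreg g (hgN g))] at hjm
  -- `S` at `g` and at the `p`-regular part of `g`
  have hS : LinearMap.trace k W (S (g ^ j)) = LinearMap.trace k W (S g) := by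
    obtain ⟨s', d', hs', htr'⟩ := Module.End.exists_trace_pow_eq_sum (S g)
    have h1 := htr' 1
    rw [pow_one] at h1
    rw [map_pow, htr', h1]
    refine Finset.sum_congr rfl fun x hx => ?_
    rw [hj x ((hs' x hx).pow_eq_one (S.pow_eq_one_of_pow_eq_one (hgN g))), pow_one]
  have hBj := hB (g ^ j)
  rw [hS] at hBj
  have hdiff : ∑ x ∈ s, (d x : k) * π x ^ 1 - LinearMap.trace k W (S g) = 0 := hT0 _ (by
    have := T.sub_mem hjm hBj
    rwa [Prod.mk_sub_mk, sub_self] at this)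
  rw [pow_one, sub_eq_zero.1 hdiff] at h1
  exact h1

/-! ### Rank and reduction -/

open Matrix in
theorem Matrix.exists_linearIndependent_rows {K m n : Type*} [Field K] [Fintype m] [Fintype n]
    (A : Matrix m n K) {r : ℕ} (hr : A.rank = r) :
    ∃ f : Fin r → m, LinearIndependent K (A.submatrix f id).row := by
  subst hr
  rw [A.rank_eq_finrank_span_row]
  obtain ⟨f, hf, -, hli⟩ := Submodule.exists_fun_fin_finrank_span_eq K (Set.range A.row)
  choose g hg using hf
  refine ⟨g, ?_⟩
  rwa [show (A.submatrix g id).row = f from funext hg]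

open Matrix in
theorem Matrix.exists_submatrix_det_ne_zero {K m n : Type*} [Field K] [Fintype m] [Fintype n]
    (A : Matrix m n K) :
    ∃ (f : Fin A.rank → m) (g : Fin A.rank → n), (A.submatrix f g).det ≠ 0 := by
  obtain ⟨f, hf⟩ := A.exists_linearIndependent_rows rfl
  have hr : (A.submatrix f id)ᵀ.rank = A.rank := by
    rw [rank_transpose, hf.rank_matrix, Fintype.card_fin]
  obtain ⟨g, hg⟩ := (A.submatrix f id)ᵀ.exists_linearIndependent_rows hr
  refine ⟨f, g, ?_⟩
  have h := linearIndependent_rows_iff_isUnit.1 hg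
  rw [isUnit_iff_isUnit_det, ← det_transpose] at h
  exact h.ne_zero

/-- Reduction does not raise the rank, since a non-zero minor lifts to a non-zero minor. -/
theorem Matrix.rank_le_rank_of_mem_subring {K L m n : Type*} [Field K] [Field L] [Fintype m]
    [Fintype n] {T : Subring (K × L)} (hT : ∀ y, ((0 : K), y) ∈ T → y = 0)
    (A : Matrix m n K) (B : Matrix m n L) (hAB : ∀ i j, (A i j, B i j) ∈ T) :
    B.rank ≤ A.rank := by
  obtain ⟨f, g, hdet⟩ := B.exists_submatrix_det_ne_zero
  let M : Matrix (Fin B.rank) (Fin B.rank) T := fun i j => ⟨_, hAB (f i) (g j)⟩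
  have hA : ((RingHom.fst K L).comp T.subtype) M.det = (A.submatrix f g).det := by
    rw [RingHom.map_det]; rfl
  have hB : ((RingHom.snd K L).comp T.subtype) M.det = (B.submatrix f g).det := by
    rw [RingHom.map_det]; rfl
  have hA0 : (A.submatrix f g).det ≠ 0 := fun h0 => hdet <| hT _ <| by
    have h : ((A.submatrix f g).det, (B.submatrix f g).det) = (M.det : K × L) := by
      rw [← hA, ← hB]; rfl
    rw [← h0, h]
    exact M.det.2
  calc B.rank = (A.submatrix f g).rank := by rw [Matrix.rank_of_det_ne_zero hA0, Fintype.card_fin]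
    _ ≤ A.rank := A.rank_submatrix_le f g

/-! ### The sign of a twisted invariant form and the rank of a matrix of character values -/

section Forms

open Matrix

variable {K G : Type*} [Field K] [Group G] {n : ℕ}

/-- The matrix with entries `χ(hg) + c μ(g)⁻¹ χ(hg⁻¹)`, where `χ` is the character of `X`. For an
invertible form `J` with `J(gx, gy) = μ(g)⁻¹ J(x, y)` the row of `g` represents
the functional `tr(X(h) (A + c A*))` for `A = X(g)` and its adjoint `A*` with respect to `J`. -/
def adjointTraceMatrix (X : G →* Matrix (Fin n) (Fin n) K) (μ : G →* K) (c : K) :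
    Matrix G G K :=
  Matrix.of fun g h => (X (h * g)).trace + c * μ g⁻¹ * (X (h * g⁻¹)).trace

variable {X : G →* Matrix (Fin n) (Fin n) K} {μ : G →* K} {J : Matrix (Fin n) (Fin n) K} {ε : K}

/-- With `Y = J X(g)` one has `J (A + c A*) = Y + cε Yᵀ`, so the row of `g` is given by a skew-symmetric
matrix if `c = -ε` and by a symmetric one if `c = ε`. -/
theorem adjointTraceMatrix_apply (hJ : IsUnit J.det) (hε : ε * ε = 1) (hJt : Jᵀ = ε • J)
    (hinv : ∀ g, (X g)ᵀ * J * X g = μ g⁻¹ • J) (c : K) (g h : G) :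
    adjointTraceMatrix X μ c g h =
      (X h * J⁻¹ * (J * X g + (c * ε) • (J * X g)ᵀ)).trace := by
  have hY : (J * X g)ᵀ = (ε * μ g⁻¹) • (J * X g⁻¹) := by
    have hone : X g * X g⁻¹ = 1 := by rw [← map_mul, mul_inv_cancel, map_one]
    rw [transpose_mul, hJt, Matrix.mul_smul, mul_smul, ← Matrix.smul_mul (μ g⁻¹), ← hinv g,
      Matrix.mul_assoc _ (X g), hone, Matrix.mul_one]
  have hc : c * ε * (ε * μ g⁻¹) = c * μ g⁻¹ := by linear_combination c * μ g⁻¹ * hε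
  rw [hY, smul_smul, hc, Matrix.mul_add, Matrix.mul_smul, trace_add, trace_smul,
    Matrix.mul_assoc, Matrix.mul_assoc, Matrix.nonsing_inv_mul_cancel_left _ _ hJ,
    Matrix.nonsing_inv_mul_cancel_left _ _ hJ, ← map_mul, ← map_mul]
  rfl

variable [Fintype G]

/-- For `c = -ε` the matrix factors through the space of skew-symmetric matrices. -/
theorem rank_adjointTraceMatrix_le (hJ : IsUnit J.det) (hε : ε * ε = 1) (hJt : Jᵀ = ε • J)
    (hinv : ∀ g, (X g)ᵀ * J * X g = μ g⁻¹ • J) :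
    (adjointTraceMatrix X μ (-ε)).rank ≤ Fintype.card {q : Fin n × Fin n // q.1 < q.2} := by
  let P : Matrix G {q : Fin n × Fin n // q.1 < q.2} K :=
    Matrix.of fun g q => (J * X g - (J * X g)ᵀ) q.1.1 q.1.2
  let Q : Matrix {q : Fin n × Fin n // q.1 < q.2} G K :=
    Matrix.of fun q h => (X h * J⁻¹) q.1.2 q.1.1 - (X h * J⁻¹) q.1.1 q.1.2
  have hPQ : adjointTraceMatrix X μ (-ε) = P * Q := by
    ext g h
    rw [adjointTraceMatrix_apply hJ hε hJt hinv, neg_mul, hε, neg_one_smul, ← sub_eq_add_neg]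
    set Z := J * X g - (J * X g)ᵀ with hZ
    have hskew : ∀ i j, Z j i = -Z i j := fun i j => by
      rw [hZ, Matrix.sub_apply, Matrix.sub_apply, transpose_apply, transpose_apply, neg_sub]
    have hdiag : ∀ i, Z i i = 0 := fun i => by
      rw [hZ, Matrix.sub_apply, transpose_apply, sub_self]
    set F := X h * J⁻¹
    have h1 : (F * Z).trace = ∑ q : Fin n × Fin n, F q.2 q.1 * Z q.1 q.2 := by
      rw [trace, Fintype.sum_prod_type_right]
      rfl
    have h2 : (P * Q) g h = ∑ q : Fin n × Fin n,
        if q.1 < q.2 then Z q.1 q.2 * (F q.2 q.1 - F q.1 q.2) else 0 := by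
      rw [Matrix.mul_apply, ← Finset.sum_filter]
      exact (Finset.sum_subtype _ (by simp)
        fun q : Fin n × Fin n => Z q.1 q.2 * (F q.2 q.1 - F q.1 q.2)).symm
    have h3 : ∑ q : Fin n × Fin n, F q.2 q.1 * Z q.1 q.2 = ∑ q : Fin n × Fin n,
        ((if q.1 < q.2 then F q.2 q.1 * Z q.1 q.2 else 0) +
          if q.2 < q.1 then F q.2 q.1 * Z q.1 q.2 else 0) := by
      refine Finset.sum_congr rfl fun q _ => ?_
      rcases lt_trichotomy q.1 q.2 with hq | hq | hq
      · simp [hq, hq.not_gt]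
      · simp [hq, hdiag]
      · simp [hq, hq.not_gt]
    have h4 : ∑ q : Fin n × Fin n, (if q.2 < q.1 then F q.2 q.1 * Z q.1 q.2 else 0) =
        ∑ q : Fin n × Fin n, if q.1 < q.2 then F q.1 q.2 * Z q.2 q.1 else 0 :=
      (Equiv.prodComm (Fin n) (Fin n)).sum_comp
        fun q => if q.1 < q.2 then F q.1 q.2 * Z q.2 q.1 else 0
    rw [h1, h2, h3, Finset.sum_add_distrib, h4, ← Finset.sum_add_distrib]
    refine Finset.sum_congr rfl fun q _ => ?_
    split_ifs
    · rw [hskew q.1 q.2]; ring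
    · simp
  rw [hPQ]
  exact (rank_mul_le_left P Q).trans P.rank_le_card_width

/-- For `c = ε` and `X` spanning the matrix algebra the rows of the matrix represent all
symmetric matrices, so its rank is the dimension of the space of symmetric matrices. -/
theorem card_le_rank_adjointTraceMatrix (h2 : (2 : K) ≠ 0) (hJ : IsUnit J.det) (hε : ε * ε = 1)
    (hJt : Jᵀ = ε • J) (hinv : ∀ g, (X g)ᵀ * J * X g = μ g⁻¹ • J)
    (hspan : ∀ Z : Matrix (Fin n) (Fin n) K, ∃ u : G → K, ∑ g, u g • X g = Z) :
    Fintype.card {q : Fin n × Fin n // q.1 ≤ q.2} ≤ (adjointTraceMatrix X μ ε).rank := by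
  choose u hu using hspan
  -- `U` combines rows into `E_ab + E_ba` and `V` combines columns into the functionals `tr(E_cd ·)`,
  -- for `a ≤ b` and `c ≤ d`; the resulting square matrix is diagonal with entries `1` and `2`.
  let U : Matrix {q : Fin n × Fin n // q.1 ≤ q.2} G K :=
    Matrix.of fun q g => u (J⁻¹ * Matrix.single q.1.1 q.1.2 1) g
  let V : Matrix G {q : Fin n × Fin n // q.1 ≤ q.2} K :=
    Matrix.of fun h q => u (Matrix.single q.1.1 q.1.2 1 * J) h
  have key : U * adjointTraceMatrix X μ ε * V =
      Matrix.diagonal fun q : {q : Fin n × Fin n // q.1 ≤ q.2} =>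
        if q.1.1 = q.1.2 then (2 : K) else 1 := by
    have hbil : ∀ q r, (U * adjointTraceMatrix X μ ε * V) q r =
        ((∑ h, V h r • X h) * J⁻¹ *
          (J * (∑ g, U q g • X g) + (J * (∑ g, U q g • X g))ᵀ)).trace := by
      intro q r
      have hW : J * (∑ g, U q g • X g) + (J * (∑ g, U q g • X g))ᵀ =
          ∑ g, U q g • (J * X g + (J * X g)ᵀ) := by
        simp only [Matrix.mul_sum, transpose_sum, Matrix.mul_smul, transpose_smul, smul_add,
          Finset.sum_add_distrib]
      rw [hW, Matrix.mul_apply]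
      simp only [Matrix.mul_apply, adjointTraceMatrix_apply hJ hε hJt hinv, hε, one_smul,
        Matrix.mul_sum, Matrix.smul_mul, Matrix.mul_smul, trace_sum, trace_smul,
        smul_eq_mul, Finset.sum_mul]
      refine Finset.sum_congr rfl fun h _ => ?_
      refine Finset.sum_congr rfl fun g _ => ?_
      ring
    ext q r
    have hUq : ∑ g, U q g • X g = J⁻¹ * Matrix.single q.1.1 q.1.2 1 := hu _
    have hVr : ∑ h, V h r • X h = Matrix.single r.1.1 r.1.2 1 * J := hu _
    rw [hbil, hUq, hVr, Matrix.mul_nonsing_inv_cancel_left _ _ hJ,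
      Matrix.mul_nonsing_inv_cancel_right _ _ hJ, transpose_single, Matrix.mul_add, trace_add]
    obtain ⟨⟨a, b⟩, hab⟩ := q
    obtain ⟨⟨c, d⟩, hcd⟩ := r
    simp only at hab hcd ⊢
    rw [Matrix.diagonal_apply, Matrix.trace_single_mul, Matrix.trace_single_mul,
      Matrix.single_apply, Matrix.single_apply]
    simp only [Subtype.mk.injEq, Prod.mk.injEq, smul_eq_mul, one_mul]
    clear hbil hUq hVr
    grind
  have hrank : (U * adjointTraceMatrix X μ ε * V).rank =
      Fintype.card {q : Fin n × Fin n // q.1 ≤ q.2} := by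
    rw [key, Matrix.rank_of_det_ne_zero]
    rw [det_diagonal, Finset.prod_ne_zero_iff]
    intro q _
    split_ifs
    exacts [h2, one_ne_zero]
  rw [← hrank]
  exact (rank_mul_le_left _ _).trans (rank_mul_le_right _ _)

theorem card_lt_pairs_lt_card_le_pairs (hn : 0 < n) :
    Fintype.card {q : Fin n × Fin n // q.1 < q.2} <
      Fintype.card {q : Fin n × Fin n // q.1 ≤ q.2} := by
  rw [Fintype.card_subtype, Fintype.card_subtype]
  refine Finset.card_lt_card ⟨fun q hq => ?_, fun h => ?_⟩
  · simp only [Finset.mem_filter, Finset.mem_univ, true_and] at hq ⊢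
    exact hq.le
  · have := @h (⟨0, hn⟩, ⟨0, hn⟩) (by simp)
    simp at this

/-- If `X₁` is an absolutely irreducible reduction of `X₀` in odd characteristic, then twisted
invariant forms of `X₀` and of `X₁` have the same sign. -/
theorem sign_ne_neg_of_reduction {L : Type*} [Field L] (h2 : (2 : L) ≠ 0) (hn : 0 < n)
    {T : Subring (K × L)} (hT : ∀ y, ((0 : K), y) ∈ T → y = 0)
    {X₀ : G →* Matrix (Fin n) (Fin n) K} {X₁ : G →* Matrix (Fin n) (Fin n) L}
    {μ₀ : G →* K} {μ₁ : G →* L}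
    (hX : ∀ g, ((X₀ g).trace, (X₁ g).trace) ∈ T) (hμ : ∀ g, (μ₀ g, μ₁ g) ∈ T)
    (hspan : ∀ Z : Matrix (Fin n) (Fin n) L, ∃ u : G → L, ∑ g, u g • X₁ g = Z)
    {ε₀ ε₁ : ℤ} (hε₀ : ε₀ * ε₀ = 1)
    {J₀ : Matrix (Fin n) (Fin n) K} (hJ₀ : IsUnit J₀.det) (hJt₀ : J₀ᵀ = (ε₀ : K) • J₀)
    (hinv₀ : ∀ g, (X₀ g)ᵀ * J₀ * X₀ g = μ₀ g⁻¹ • J₀)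
    {J₁ : Matrix (Fin n) (Fin n) L} (hJ₁ : IsUnit J₁.det) (hJt₁ : J₁ᵀ = (ε₁ : L) • J₁)
    (hinv₁ : ∀ g, (X₁ g)ᵀ * J₁ * X₁ g = μ₁ g⁻¹ • J₁) : ε₁ ≠ -ε₀ := by
  rintro rfl
  have h0 := rank_adjointTraceMatrix_le hJ₀ (by exact_mod_cast congrArg (Int.cast (R := K)) hε₀)
    hJt₀ hinv₀
  have h1 := card_le_rank_adjointTraceMatrix h2 hJ₁
    (by rw [← Int.cast_mul, neg_mul_neg, hε₀, Int.cast_one]) hJt₁ hinv₁ hspan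
  have hle := Matrix.rank_le_rank_of_mem_subring hT (adjointTraceMatrix X₀ μ₀ (-(ε₀ : K)))
    (adjointTraceMatrix X₁ μ₁ ((-ε₀ : ℤ) : L)) fun g h => by
      have hc : (-(ε₀ : K), ((-ε₀ : ℤ) : L)) ∈ T := by
        rw [← Int.cast_neg]
        exact intCast_mem T (-ε₀)
      exact T.add_mem (hX _) (T.mul_mem (T.mul_mem hc (hμ _)) (hX _))
  exact absurd (h1.trans (hle.trans h0)) (card_lt_pairs_lt_card_le_pairs hn).not_ge

end Forms

/-! ### A non-zero twisted indicator produces an invariant form -/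

section Indicator

open Matrix

/-- The trace of `A ↦ Mᵀ Aᵀ M` is the trace of `M ^ 2`. -/
theorem Matrix.trace_transpose_conj {K : Type*} [Field K] {n : ℕ} (M : Matrix (Fin n) (Fin n) K) :
    LinearMap.trace K (Matrix (Fin n) (Fin n) K)
      (LinearMap.mulLeft K Mᵀ ∘ₗ LinearMap.mulRight K M ∘ₗ
        (Matrix.transposeLinearEquiv (Fin n) (Fin n) K K).toLinearMap) = (M * M).trace := by
  rw [LinearMap.trace_eq_matrix_trace K (Matrix.stdBasis K (Fin n) (Fin n)), Matrix.trace,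
    Fintype.sum_prod_type, Matrix.trace]
  refine Finset.sum_congr rfl fun i _ => ?_
  rw [Matrix.diag_apply, Matrix.mul_apply]
  refine Finset.sum_congr rfl fun j _ => ?_
  rw [Matrix.diag_apply, LinearMap.toMatrix_apply, Matrix.stdBasis_eq_single]
  have hrepr : ∀ A : Matrix (Fin n) (Fin n) K, (Matrix.stdBasis K (Fin n) (Fin n)).repr A (i, j) =
      A i j := fun A => by
    simp [Matrix.stdBasis]
  rw [hrepr]
  simp [Matrix.mul_apply, Matrix.single_apply, ite_and, mul_comm]

/-- The matrix representation afforded by a basis. -/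
noncomputable def Representation.matrixHom {K G V ι : Type*} [Field K] [Group G] [AddCommGroup V]
    [Module K V] [Fintype ι] [DecidableEq ι] (ρ : Representation K G V) (e : Module.Basis ι K V) :
    G →* Matrix ι ι K :=
  ((LinearMap.toMatrixAlgEquiv e : Module.End K V →ₐ[K] Matrix ι ι K) :
    Module.End K V →* Matrix ι ι K).comp ρ

theorem Representation.matrixHom_apply {K G V ι : Type*} [Field K] [Group G] [AddCommGroup V]
    [Module K V] [Fintype ι] [DecidableEq ι] (ρ : Representation K G V) (e : Module.Basis ι K V)
    (g : G) : ρ.matrixHom e g = LinearMap.toMatrix e e (ρ g) := rfl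

theorem Representation.trace_matrixHom {K G V ι : Type*} [Field K] [Group G] [AddCommGroup V]
    [Module K V] [Fintype ι] [DecidableEq ι] (ρ : Representation K G V) (e : Module.Basis ι K V)
    (g : G) : (ρ.matrixHom e g).trace = LinearMap.trace K V (ρ g) := by
  rw [LinearMap.trace_eq_matrix_trace K e, ρ.matrixHom_apply]

variable {G : Type*} [Group G] [Fintype G] {n : ℕ}

/-- The twisted indicator is the trace of the composition of transposition with the projection
onto the twisted invariant forms. If it is `ε = ±1` but every invariant form had sign `-ε`, then
that trace would be `-ε` times the dimension of the space of invariant forms. -/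
theorem exists_invariant_form_of_indicator (X : G →* Matrix (Fin n) (Fin n) ℂ) (μ : G →* ℂ)
    {ε : ℤ} (hε : ε * ε = 1) (h : twistedIndicator μ (fun g => (X g).trace) = ε) :
    ∃ J : Matrix (Fin n) (Fin n) ℂ, J ≠ 0 ∧ Jᵀ = (ε : ℂ) • J ∧
      ∀ g, (X g)ᵀ * J * X g = μ g⁻¹ • J := by
  have hεC : (ε : ℂ) * ε = 1 := by exact_mod_cast congrArg (Int.cast (R := ℂ)) hε
  have hN : (Fintype.card G : ℂ) ≠ 0 := Nat.cast_ne_zero.2 Fintype.card_ne_zero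
  let V : Submodule ℂ (Matrix (Fin n) (Fin n) ℂ) :=
    { carrier := {J | ∀ g, (X g)ᵀ * J * X g = μ g⁻¹ • J}
      zero_mem' := fun g => by simp
      add_mem' := fun {A B} hA hB g => by
        rw [Matrix.mul_add, Matrix.add_mul, hA g, hB g, smul_add]
      smul_mem' := fun c A hA g => by
        rw [Matrix.mul_smul, Matrix.smul_mul, hA g, smul_comm] }
  let P : Module.End ℂ (Matrix (Fin n) (Fin n) ℂ) :=
    (1 / (Fintype.card G : ℂ)) • ∑ g, μ g • (LinearMap.mulLeft ℂ (X g)ᵀ ∘ₗ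
      LinearMap.mulRight ℂ (X g))
  have hPapply : ∀ A, P A = (1 / (Fintype.card G : ℂ)) • ∑ g, μ g • ((X g)ᵀ * A * X g) := by
    intro A
    simp [P, LinearMap.sum_apply, Matrix.mul_assoc]
  have hP : LinearMap.IsProj V P := by
    refine ⟨fun A h => ?_, fun A hA => ?_⟩
    · rw [hPapply, Matrix.mul_smul, Matrix.smul_mul, smul_comm (μ h⁻¹)]
      congr 1
      rw [Matrix.mul_sum, Matrix.sum_mul, Finset.smul_sum]
      refine Fintype.sum_equiv (Equiv.mulRight h) _ _ fun g => ?_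
      have hμ : μ h⁻¹ * μ (g * h) = μ g := by
        rw [mul_comm, ← map_mul, mul_inv_cancel_right]
      rw [Equiv.coe_mulRight, Matrix.mul_smul, Matrix.smul_mul, smul_smul, hμ, map_mul,
        transpose_mul]
      simp only [Matrix.mul_assoc]
    · rw [hPapply]
      have : ∀ g, μ g • ((X g)ᵀ * A * X g) = A := fun g => by
        rw [hA g, smul_smul, ← map_mul, mul_inv_cancel, map_one, one_smul]
      rw [Finset.sum_congr rfl fun g _ => this g, Finset.sum_const, Finset.card_univ,
        ← Nat.cast_smul_eq_nsmul ℂ, smul_smul, one_div, inv_mul_cancel₀ hN, one_smul]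
  let τ : Module.End ℂ (Matrix (Fin n) (Fin n) ℂ) :=
    (Matrix.transposeLinearEquiv (Fin n) (Fin n) ℂ ℂ).toLinearMap
  have hτ : ∀ A, τ A = Aᵀ := fun A => rfl
  have htr : LinearMap.trace ℂ _ (P * τ) = ε := by
    rw [← h, twistedIndicator]
    rw [smul_mul_assoc, map_smul, Finset.sum_mul, map_sum, smul_eq_mul]
    simp only [smul_mul_assoc, map_smul, smul_eq_mul]
    congr 1
    refine Finset.sum_congr rfl fun g _ => ?_
    rw [pow_two, X.map_mul, ← Matrix.trace_transpose_conj]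
    rfl
  by_contra hno
  push Not at hno
  have hskew : τ * P = -(ε : ℂ) • P := by
    refine LinearMap.ext fun A => ?_
    have hB := hP.map_mem A
    set B := P A with hBdef
    have hsum : B + (ε : ℂ) • Bᵀ = 0 := by
      by_contra hne
      obtain ⟨g, hg⟩ := hno _ hne (by
        rw [transpose_add, transpose_smul, transpose_transpose, smul_add, smul_smul, hεC, one_smul,
          add_comm])
      apply hg
      have ht : (X g)ᵀ * Bᵀ * X g = μ g⁻¹ • Bᵀ := by
        have := congrArg transpose (hB g)
        rwa [transpose_mul, transpose_mul, transpose_transpose, transpose_smul,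
          ← Matrix.mul_assoc] at this
      rw [Matrix.mul_add, Matrix.add_mul, hB g, Matrix.mul_smul, Matrix.smul_mul, ht, smul_add,
        smul_comm]
    have h1 : (ε : ℂ) • (B + (ε : ℂ) • Bᵀ) = 0 := by rw [hsum, smul_zero]
    rw [smul_add, smul_smul, hεC, one_smul] at h1
    rw [Module.End.mul_apply, ← hBdef, hτ, LinearMap.smul_apply, ← hBdef, neg_smul]
    exact eq_neg_of_add_eq_zero_right h1
  rw [LinearMap.trace_mul_comm, hskew, map_smul, hP.trace, smul_eq_mul, neg_mul] at htr
  have h1 : -(Module.finrank ℂ V : ℂ) = 1 := by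
    linear_combination (ε : ℂ) * htr + (1 + (Module.finrank ℂ V : ℂ)) * hεC
  have h2 : -(Module.finrank ℂ V : ℤ) = 1 := by exact_mod_cast h1
  omega

/-- A non-zero invariant form of an irreducible representation is non-degenerate. -/
theorem isUnit_det_of_invariant {K V : Type*} [Field K] [AddCommGroup V] [Module K V]
    {G : Type*} [Group G] (ρ : Representation K G V)
    (hρ : ρ.IsIrreducible) (e : Module.Basis (Fin n) K V) (μ : G →* K)
    {J : Matrix (Fin n) (Fin n) K} (hJ : J ≠ 0)
    (hinv : ∀ g, (ρ.matrixHom e g)ᵀ * J * ρ.matrixHom e g = μ g⁻¹ • J) : IsUnit J.det := by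
  have hcomm : ∀ g, J * ρ.matrixHom e g = μ g⁻¹ • ((ρ.matrixHom e g⁻¹)ᵀ * J) := fun g => by
    rw [← Matrix.mul_smul, ← hinv g, ← Matrix.mul_assoc, ← Matrix.mul_assoc, ← transpose_mul,
      ← map_mul, mul_inv_cancel, map_one, transpose_one, Matrix.one_mul]
  let N : Subrepresentation ρ :=
    { toSubmodule := (LinearMap.ker J.mulVecLin).comap e.equivFun.toLinearMap
      apply_mem_toSubmodule := fun g v hv => by
        simp only [Submodule.mem_comap, LinearMap.mem_ker, LinearEquiv.coe_coe,
          Matrix.mulVecLin_apply] at hv ⊢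
        have hrep : e.equivFun (ρ g v) = ρ.matrixHom e g *ᵥ e.equivFun v := by
          rw [ρ.matrixHom_apply, Module.Basis.equivFun_apply, Module.Basis.equivFun_apply,
            LinearMap.toMatrix_mulVec_repr]
        rw [hrep, Matrix.mulVec_mulVec, hcomm, Matrix.smul_mulVec, ← Matrix.mulVec_mulVec, hv,
          Matrix.mulVec_zero, smul_zero] }
  rw [isUnit_iff_ne_zero]
  intro hdet
  obtain ⟨v, hv0, hv⟩ := Matrix.exists_mulVec_eq_zero_iff.2 hdet
  rcases hρ.eq_bot_or_eq_top N with hN | hN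
  · have hmem : e.equivFun.symm v ∈ N := by
      change J *ᵥ e.equivFun (e.equivFun.symm v) = 0
      rw [LinearEquiv.apply_symm_apply, hv]
    rw [hN] at hmem
    exact hv0 ((LinearEquiv.map_eq_zero_iff _).1 (show e.equivFun.symm v = 0 from hmem))
  · apply hJ
    refine Matrix.ext_of_mulVec_single fun i => ?_
    have hmem : e.equivFun.symm (Pi.single i 1) ∈ N := by
      rw [hN]; trivial
    change J *ᵥ e.equivFun (e.equivFun.symm (Pi.single i 1)) = 0 at hmem
    rw [LinearEquiv.apply_symm_apply] at hmem
    rw [hmem, Matrix.zero_mulVec]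

end Indicator

/-! ### The lemmas of Schur and Burnside -/

/-- **Schur's lemma** over an algebraically closed field. -/
theorem Representation.IsIrreducible.exists_eq_smul_id {K G V : Type*} [Field K] [IsAlgClosed K]
    [Group G] [AddCommGroup V] [Module K V] [FiniteDimensional K V]
    {ρ : Representation K G V} (hρ : ρ.IsIrreducible) (f : Module.End K V)
    (hf : ∀ g v, f (ρ g v) = ρ g (f v)) : ∃ c : K, ∀ v, f v = c • v := by
  obtain ⟨c, hc⟩ := (hρ.algebraMap_intertwiningMap_bijective_of_isAlgClosed).2
    (f.intertwiningMap_of_isIntertwiningMap ρ ρ hf)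
  refine ⟨c, fun v => ?_⟩
  exact (congrArg (fun φ : ρ.IntertwiningMap ρ => φ v) hc).symm

/-- **Burnside's theorem**: the operators of an irreducible representation over an algebraically
closed field span the full endomorphism algebra. -/
theorem Representation.IsIrreducible.exists_sum_smul_eq {K G V : Type*} [Field K] [IsAlgClosed K]
    [Group G] [Fintype G] [AddCommGroup V] [Module K V] [FiniteDimensional K V]
    {ρ : Representation K G V} (hρ : ρ.IsIrreducible) (f : Module.End K V) :
    ∃ u : G → K, ∑ g, u g • ρ g = f := by
  have hsimple : IsSimpleModule (MonoidAlgebra K G) ρ.asModule :=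
    ρ.irreducible_iff_isSimpleModule_asModule.1 hρ
  let F : Module.End (Module.End (MonoidAlgebra K G) ρ.asModule) ρ.asModule :=
    { toFun := fun v => f v
      map_add' := f.map_add
      map_smul' := fun φ v => by
        obtain ⟨c, hc⟩ := hρ.exists_eq_smul_id
          ((Representation.IntertwiningMap.equivLinearMapAsModule ρ ρ).symm φ).toLinearMap
          fun g v => Representation.IntertwiningMap.isIntertwining _ _ _ g v
        have hφ : ∀ v, φ v = (c • v : V) := hc
        change f (φ v) = φ (f v)
        rw [hφ]
        exact (f.map_smul c v).trans (hφ (f v)).symm }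
  let e := Module.finBasis K V
  classical
  obtain ⟨r, hr⟩ := jacobson_density F (Finset.univ.image fun i => (e i : ρ.asModule))
  have hf : f = ρ.asAlgebraHom r := e.ext fun i =>
    hr (e i) (Finset.mem_image_of_mem _ (Finset.mem_univ i))
  refine (Submodule.mem_span_range_iff_exists_fun K).1 ?_
  rw [hf]
  clear hr hf
  induction r using MonoidAlgebra.induction_linear with
  | zero => rw [map_zero]; exact Submodule.zero_mem _
  | add x y hx hy => rw [map_add]; exact Submodule.add_mem _ hx hy
  | single g c =>
    rw [Representation.asAlgebraHom_single]
    exact Submodule.smul_mem _ _ (Submodule.subset_span ⟨g, rfl⟩)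

/-! ### The indicator determines the sign of the twisted form of the reduction -/

section Sign

theorem brauerCharacter_one {k G V : Type*} [Field k] [Group G] [AddCommGroup V] [Module k V]
    [FiniteDimensional k V] (θ : CommGroup.torsion kˣ →* ℂˣ) (ρ : Representation k G V) :
    brauerCharacter θ ρ 1 = Module.finrank k V := by
  have hex : ∃ z : CommGroup.torsion kˣ, ((z : kˣ) : k) = 1 := ⟨1, rfl⟩
  have h1 : hex.choose = 1 := Subtype.ext (Units.ext hex.choose_spec)
  rw [brauerCharacter, map_one, LinearMap.charpoly_one, ← Polynomial.C_1, Polynomial.roots_pow,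
    Polynomial.roots_X_sub_C,
    Multiset.map_nsmul, Multiset.sum_nsmul, Multiset.map_singleton, Multiset.sum_singleton,
    dif_pos hex, h1, map_one, Units.val_one, nsmul_eq_mul, mul_one]

theorem trace_linearRep {k G : Type*} [Field k] [Group G] (lam : G →* kˣ) (g : G) :
    LinearMap.trace k k (linearRep lam g) = lam g := by
  have : linearRep lam g = (lam g : k) • (LinearMap.id : k →ₗ[k] k) := rfl
  rw [this, map_smul, LinearMap.trace_id, Module.finrank_self, Nat.cast_one, smul_eq_mul, mul_one]

/-- An irreducible character that lifts the Brauer character of a linear character is linear. -/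
theorem exists_monoidHom_of_liftsBrauer_linearRep {k G : Type*} [Field k] [Group G] (p : ℕ)
    (θ : CommGroup.torsion kˣ →* ℂˣ) (lam : G →* kˣ) {μ : G → ℂ}
    (hμ : IsIrreducibleCharacter μ) (hμl : LiftsBrauer p μ (brauerCharacter θ (linearRep lam))) :
    ∃ μ₀ : G →* ℂ, ⇑μ₀ = μ := by
  obtain ⟨m, Y, -, rfl⟩ := hμ
  have h1 : Y.character 1 = 1 := by
    rw [hμl 1 (by simp), brauerCharacter_one, Module.finrank_self, Nat.cast_one]
  rw [Representation.char_one, Module.finrank_fin_fun, Nat.cast_eq_one] at h1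
  subst h1
  refine ⟨(Matrix.detMonoidHom (R := ℂ) (n := Fin 1)).comp
    (Y.matrixHom (Pi.basisFun ℂ (Fin 1))), ?_⟩
  funext g
  have : Y.character g = (Y.matrixHom (Pi.basisFun ℂ (Fin 1)) g).trace :=
    (Y.trace_matrixHom _ g).symm
  rw [this, Matrix.trace_fin_one]
  exact Matrix.det_fin_one _

/-- If the twisted indicator of a lift `χ` of `S` is `ε₀ = ±1`, then a `λ⁻¹`-valued form on `S` cannot
have sign `-ε₀`. No representation is reduced: only the values of `χ` and `μ` are. -/
theorem sign_ne_neg_twistedIndicator {k G V : Type*} [Field k] [IsAlgClosed k] (p : ℕ)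
    [Fact p.Prime] (hp2 : p ≠ 2) [CharP k p] [Group G] [Fintype G] [AddCommGroup V] [Module k V]
    [FiniteDimensional k V] (S : Representation k G V) (hS : S.IsIrreducible) (lam : G →* kˣ)
    (θ : CommGroup.torsion kˣ →* ℂˣ) (hθ : Function.Injective θ)
    {χ μ : G → ℂ} (hχ : IsIrreducibleCharacter χ) (hμ : IsIrreducibleCharacter μ)
    (hχS : LiftsBrauer p χ (brauerCharacter θ S))
    (hμl : LiftsBrauer p μ (brauerCharacter θ (linearRep lam)))
    {ε₀ ε₁ : ℤ} (hε₀ : ε₀ * ε₀ = 1) (hind : twistedIndicator μ χ = ε₀)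
    {ψ : LinearMap.BilinForm k V} (hψ0 : ψ ≠ 0) (hψt : ∀ v w, ψ w v = ε₁ * ψ v w)
    (hψinv : ∀ g v w, ψ (S g v) (S g w) = (lam g⁻¹ : k) * ψ v w) : ε₁ ≠ -ε₀ := by
  classical
  have h2 : (2 : k) ≠ 0 := Ring.two_ne_zero (ringChar.eq k p ▸ hp2)
  obtain ⟨T, hT0, hT1, hTθ⟩ := exists_reduction_subring p θ hθ (Fintype.card G)
    Fintype.card_ne_zero
  -- `μ` is linear and reduces to `λ`
  have hμT : ∀ g, (μ g, (lam g : k)) ∈ T := fun g => by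
    obtain ⟨m, Y, -, rfl⟩ := hμ
    have := character_trace_mem p θ hT0 hT1 hTθ Y (linearRep lam) hμl g
    rwa [trace_linearRep] at this
  obtain ⟨μ₀, rfl⟩ := exists_monoidHom_of_liftsBrauer_linearRep p θ lam hμ hμl
  -- matrices for `χ` and for `S`, of the same size
  obtain ⟨n, X, hX, rfl⟩ := hχ
  have hn : Module.finrank k V = n := by
    have h1 := hχS 1 (by simp)
    rw [brauerCharacter_one, Representation.char_one, Module.finrank_fin_fun, Nat.cast_inj] at h1
    exact h1.symm
  let e₀ := Pi.basisFun ℂ (Fin n)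
  let e := Module.finBasisOfFinrankEq k V hn
  have hn0 : 0 < n := by
    rw [Nat.pos_iff_ne_zero]
    rintro rfl
    apply hψ0
    have := Module.finrank_zero_iff.1 hn
    exact Subsingleton.elim _ _
  have hchar : (fun g => (X.matrixHom e₀ g).trace) = X.character :=
    funext fun g => X.trace_matrixHom e₀ g
  obtain ⟨J₀, hJ₀, hJt₀, hinv₀⟩ := exists_invariant_form_of_indicator (X.matrixHom e₀) μ₀ hε₀
    (by rw [hchar]; exact hind)
  let J₁ := LinearMap.BilinForm.toMatrix e ψ
  let lam' : G →* k := (Units.coeHom k).comp lam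
  have hinv₁ : ∀ g, (S.matrixHom e g).transpose * J₁ * S.matrixHom e g = lam' g⁻¹ • J₁ := by
    intro g
    rw [S.matrixHom_apply, ← LinearMap.BilinForm.toMatrix_comp, ← map_smul]
    congr 1
    ext v w
    exact hψinv g v w
  have hJ₁ : J₁ ≠ 0 := (LinearEquiv.map_ne_zero_iff _).2 hψ0
  have hJt₁ : J₁.transpose = (ε₁ : k) • J₁ := by
    ext i j
    simp [J₁, LinearMap.BilinForm.toMatrix_apply, hψt (e i) (e j)]
  refine sign_ne_neg_of_reduction h2 hn0 hT0 (X₀ := X.matrixHom e₀) (X₁ := S.matrixHom e)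
    (μ₀ := μ₀) (μ₁ := lam') (fun g => ?_) hμT (fun Z => ?_) hε₀
    (isUnit_det_of_invariant X hX e₀ μ₀ hJ₀ hinv₀) hJt₀ hinv₀
    (isUnit_det_of_invariant S hS e lam' hJ₁ hinv₁) hJt₁ hinv₁
  · rw [S.trace_matrixHom, X.trace_matrixHom]
    exact character_trace_mem p θ hT0 hT1 hTθ X S hχS g
  · obtain ⟨u, hu⟩ := hS.exists_sum_smul_eq (Matrix.toLin e e Z)
    refine ⟨u, ?_⟩
    have := congrArg (LinearMap.toMatrix e e) hu
    rw [LinearMap.toMatrix_toLin, map_sum] at this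
    simpa only [map_smul] using! this

end Sign

/-! ### Averaging linear maps with a relative trace -/

section Average

open Representation

variable {k G V W U : Type*} [Field k] [Group G] [AddCommGroup V] [Module k V]
  [AddCommGroup W] [Module k W] [AddCommGroup U] [Module k U]

theorem Representation.IntertwiningMap.apply_asAlgebraHom {ρ : Representation k G V}
    {σ : Representation k G W} (f : IntertwiningMap ρ σ) (x : MonoidAlgebra k G) (v : V) :
    f (ρ.asAlgebraHom x v) = σ.asAlgebraHom x (f v) := by
  induction x using MonoidAlgebra.induction_linear with
  | zero => simp
  | add x y hx hy => simp [hx, hy]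
  | single g c => simp [f.isIntertwining]

variable [Finite G]

theorem asAlgebraHom_relTrace_apply (τ : Representation k G U) (D : Subgroup G)
    (a : MonoidAlgebra k G) (u : U) :
    τ.asAlgebraHom (relTrace D a) u =
      ∑ᶠ t : G ⧸ D, τ t.out (τ.asAlgebraHom a (τ t.out⁻¹ u)) := by
  have := Fintype.ofFinite (G ⧸ D)
  rw [relTrace, finsum_eq_sum_of_fintype, finsum_eq_sum_of_fintype, map_sum, LinearMap.sum_apply]
  refine Finset.sum_congr rfl fun t _ => ?_
  rw [map_mul, map_mul, asAlgebraHom_of, asAlgebraHom_of]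
  rfl

/-- The average `∑_{t ∈ G/D} t a f t⁻¹` of a linear map `f : V → W`. -/
noncomputable def relAverage (D : Subgroup G) (a : MonoidAlgebra k G) (ρ : Representation k G V)
    (σ : Representation k G W) (f : V →ₗ[k] W) : V →ₗ[k] W :=
  ∑ᶠ t : G ⧸ D, σ t.out ∘ₗ σ.asAlgebraHom a ∘ₗ f ∘ₗ ρ t.out⁻¹

variable {D : Subgroup G} {a : MonoidAlgebra k G} {ρ : Representation k G V}
  {σ : Representation k G W} {τ : Representation k G U} {f : V →ₗ[k] W}

theorem relAverage_apply (v : V) : relAverage D a ρ σ f v =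
    ∑ᶠ t : G ⧸ D, σ t.out (σ.asAlgebraHom a (f (ρ t.out⁻¹ v))) := by
  have := Fintype.ofFinite (G ⧸ D)
  rw [relAverage, finsum_eq_sum_of_fintype, finsum_eq_sum_of_fintype, LinearMap.sum_apply]
  rfl

/-- The average is `G`-equivariant if `a` and `f` are `D`-equivariant. -/
theorem relAverage_isIntertwining
    (ha : ∀ x ∈ D, MonoidAlgebra.of k G x * a * MonoidAlgebra.of k G x⁻¹ = a)
    (hf : ∀ x ∈ D, ∀ v, f (ρ x v) = σ x (f v)) (g : G) (v : V) :
    relAverage D a ρ σ f (ρ g v) = σ g (relAverage D a ρ σ f v) := by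
  have := Fintype.ofFinite (G ⧸ D)
  have haσ : ∀ x ∈ D, ∀ w, σ x (σ.asAlgebraHom a (σ x⁻¹ w)) = σ.asAlgebraHom a w := by
    intro x hx w
    conv_rhs => rw [← ha x hx, map_mul, map_mul, asAlgebraHom_of, asAlgebraHom_of]
    rfl
  -- the summand depends only on the coset
  have hcoset : ∀ (s t : G), (s : G ⧸ D) = t → ∀ v,
      σ s (σ.asAlgebraHom a (f (ρ s⁻¹ v))) = σ t (σ.asAlgebraHom a (f (ρ t⁻¹ v))) := by
    intro s t hst v
    obtain ⟨x, hx, rfl⟩ : ∃ x ∈ D, t = s * x :=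
      ⟨s⁻¹ * t, QuotientGroup.eq.1 hst, by group⟩
    rw [map_mul, mul_inv_rev, map_mul, Module.End.mul_apply, Module.End.mul_apply,
      hf _ (D.inv_mem hx), haσ x hx]
  rw [relAverage_apply, relAverage_apply, finsum_eq_sum_of_fintype, finsum_eq_sum_of_fintype,
    map_sum]
  refine Fintype.sum_equiv (MulAction.toPerm g⁻¹) _ _ fun t => ?_
  have h := hcoset (g * (g⁻¹ • t).out) t.out (by
    rw [← smul_eq_mul, ← MulAction.Quotient.smul_coe]
    simp) (ρ g v)
  rw [MulAction.toPerm_apply, ← h, map_mul, mul_inv_rev, map_mul, Module.End.mul_apply,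
    Module.End.mul_apply, ← Module.End.mul_apply (ρ g⁻¹), ← map_mul, inv_mul_cancel, map_one,
    Module.End.one_apply]

/-- Averaging keeps the restriction `f ∘ j` if it is equivariant and `Tr_D^G(a)` acts trivially. -/
theorem relAverage_comp (j : IntertwiningMap τ ρ) (i : IntertwiningMap τ σ)
    (hji : ∀ u, f (j u) = i u) (u : U) :
    relAverage D a ρ σ f (j u) = i (τ.asAlgebraHom (relTrace D a) u) := by
  have := Fintype.ofFinite (G ⧸ D)
  rw [relAverage_apply, asAlgebraHom_relTrace_apply, finsum_eq_sum_of_fintype,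
    finsum_eq_sum_of_fintype, map_sum]
  refine Finset.sum_congr rfl fun t _ => ?_
  rw [← j.isIntertwining, hji, ← i.apply_asAlgebraHom, ← i.isIntertwining]

/-- Averaging keeps the composition `r ∘ f` if it is equivariant and `Tr_D^G(a)` acts trivially. -/
theorem comp_relAverage (r : IntertwiningMap σ τ) (q : IntertwiningMap ρ τ)
    (hrq : ∀ v, r (f v) = q v) (v : V) :
    r (relAverage D a ρ σ f v) = q (ρ.asAlgebraHom (relTrace D a) v) := by
  have := Fintype.ofFinite (G ⧸ D)
  rw [relAverage_apply, asAlgebraHom_relTrace_apply, finsum_eq_sum_of_fintype,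
    finsum_eq_sum_of_fintype, map_sum, map_sum]
  refine Finset.sum_congr rfl fun t _ => ?_
  rw [r.isIntertwining, r.apply_asAlgebraHom, hrq, ← q.apply_asAlgebraHom, ← q.isIntertwining]

end Average

/-! ### The action of the defect group -/

section Extension

open Representation

variable {k G VS VM : Type*} [Field k] [Group G] [AddCommGroup VS] [Module k VS]
  [AddCommGroup VM] [Module k VM] {lam : G →* kˣ}
  {S : Representation k G VS} {M : Representation k G VM}

theorem twistRep_apply (ρ : Representation k G VS) (g : G) (s : VS) :
    twistRep lam ρ g s = (lam g : k) • ρ g s := rfl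

theorem Representation.IsIrreducible.nontrivial (hS : S.IsIrreducible) : Nontrivial VS := by
  by_contra h
  rw [not_nontrivial_iff_subsingleton] at h
  exact bot_ne_top (α := Subrepresentation S)
    (Subrepresentation.toSubmodule_injective (Subsingleton.elim _ _))

/-- A normal cyclic `p`-subgroup acts trivially on irreducible modules in characteristic `p`. -/
theorem Representation.IsIrreducible.apply_eq_one_of_mem [IsAlgClosed k] [FiniteDimensional k VS]
    (hS : S.IsIrreducible) (p : ℕ) [Fact p.Prime] [CharP k p] (D : Subgroup G) [hD : D.Normal]
    {d : G} (hd : ∀ x ∈ D, x ∈ Subgroup.zpowers d) (hdD : d ∈ D) {a : ℕ} (ha : d ^ p ^ a = 1)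
    {x : G} (hx : x ∈ D) : S x = 1 := by
  have hfix : ∀ v, S d v = v → ∀ y ∈ D, S y v = v := by
    intro v hv y hy
    obtain ⟨z, rfl⟩ := Subgroup.mem_zpowers_iff.1 (hd y hy)
    let H : Subgroup G :=
      { carrier := {y | S y v = v}
        one_mem' := by simp
        mul_mem' := fun {y z} hy hz => by
          change S (y * z) v = v
          rw [map_mul, Module.End.mul_apply, hz, hy]
        inv_mem' := fun {y} hy => by
          change S y⁻¹ v = v
          conv_lhs => rw [← (hy : S y v = v)]
          rw [← Module.End.mul_apply, ← map_mul, inv_mul_cancel, map_one, Module.End.one_apply] }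
    exact H.zpow_mem (show d ∈ H from hv) z
  let F : Subrepresentation S :=
    { toSubmodule := LinearMap.ker (S d - 1)
      apply_mem_toSubmodule := fun g v hv => by
        rw [LinearMap.mem_ker, LinearMap.sub_apply, Module.End.one_apply, sub_eq_zero] at hv ⊢
        have h := hfix v hv _ (hD.conj_mem d hdD g⁻¹)
        rw [inv_inv] at h
        conv_rhs => rw [← h]
        rw [← Module.End.mul_apply, ← Module.End.mul_apply, ← map_mul, ← map_mul]
        congr 2
        group }
  have := hS.nontrivial
  obtain ⟨y, hy⟩ := Module.End.exists_eigenvalue (S d)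
  have hy1 : y = 1 := by
    have h1 := hy.pow_eq_one (S.pow_eq_one_of_pow_eq_one ha)
    have h : (y - 1) ^ p ^ a = 0 := by rw [sub_pow_char_pow, h1, one_pow, sub_self]
    exact sub_eq_zero.1 (pow_eq_zero_iff (pow_ne_zero _ (Fact.out : p.Prime).ne_zero) |>.1 h)
  subst hy1
  obtain ⟨v, hv⟩ := hy.exists_hasEigenvector
  have hvd : S d v = v := by rw [hv.apply_eq_smul, one_smul]
  have hvF : v ∈ F := by
    change (S d - 1) v = 0
    rw [LinearMap.sub_apply, Module.End.one_apply, hvd, sub_self]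
  rcases hS.eq_bot_or_eq_top F with h | h
  · rw [h] at hvF
    exact absurd hvF hv.2
  · refine LinearMap.ext fun w => ?_
    have hw : w ∈ F := by rw [h]; trivial
    refine hfix w ?_ x hx
    have : (S d - 1) w = 0 := hw
    rwa [LinearMap.sub_apply, Module.End.one_apply, sub_eq_zero] at this

/-- On an extension of `S` by `λS` the operator `d - 1` of a generator `d` of the defect group is a
scalar multiple of the composition of the quotient map and the inclusion. It factors through a
linear endomorphism of `S`, and the relation `g d g⁻¹ = d ^ n(g)` makes this endomorphism
`G`-equivariant because `(d - 1)² = 0`. -/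
theorem exists_apply_generator_pow_eq [IsAlgClosed k] [FiniteDimensional k VS]
    (hS : S.IsIrreducible) (i : IntertwiningMap (twistRep lam S) M) (q : IntertwiningMap M S)
    (hi : Function.Injective i) (hq : Function.Surjective q) (hex : Function.Exact i q) {d : G}
    (hSd : S d = 1) (hld : lam d = 1)
    (hconj : ∀ g, ∃ n : ℕ, g * d * g⁻¹ = d ^ n ∧ (lam g : k) = n) :
    ∃ c : k, ∀ (n : ℕ) m, M (d ^ n) m = m + (n * c) • i (q m) := by
  obtain ⟨s, hs⟩ := q.toLinearMap.exists_rightInverse_of_surjective (LinearMap.range_eq_top.2 hq)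
  obtain ⟨r, hr⟩ := i.toLinearMap.exists_leftInverse_of_injective (LinearMap.ker_eq_bot.2 hi)
  have hs' : ∀ v, q (s v) = v := fun v => LinearMap.congr_fun hs v
  have hr' : ∀ v, r (i v) = v := fun v => LinearMap.congr_fun hr v
  have hqi : ∀ v, q (i v) = 0 := fun v => (hex _).2 ⟨v, rfl⟩
  set N : Module.End k VM := M d - 1 with hN
  have hNapply : ∀ m, N m = M d m - m := fun m => rfl
  have hqN : ∀ m, q (N m) = 0 := fun m => by
    rw [hNapply, map_sub, q.isIntertwining, hSd, Module.End.one_apply, sub_self]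
  have hNi : ∀ v, N (i v) = 0 := fun v => by
    rw [hNapply, ← i.isIntertwining, twistRep_apply, hld, hSd, Units.val_one, one_smul,
      Module.End.one_apply, sub_self]
  let C : Module.End k VS := r ∘ₗ N ∘ₗ s
  have hC : ∀ m, i (C (q m)) = N m := by
    intro m
    obtain ⟨x, hx⟩ := (hex (s (q m) - m)).1 (by rw [map_sub, hs', sub_self])
    have h1 : N (s (q m)) = N m := by
      rw [← sub_eq_zero, ← map_sub, ← hx, hNi]
    obtain ⟨y, hy⟩ := (hex (N m)).1 (hqN m)
    change i (r (N (s (q m)))) = N m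
    rw [h1, ← hy, hr']
  have hNN : ∀ m, N (N m) = 0 := fun m => by rw [← hC m, hNi]
  have hpow : ∀ (n : ℕ) m, M (d ^ n) m = m + (n : k) • N m := by
    intro n
    induction n with
    | zero => simp
    | succ n ih =>
      intro m
      have hMd : M d m = m + N m := by rw [hNapply, add_sub_cancel]
      rw [pow_succ, map_mul, Module.End.mul_apply, hMd, map_add, ih, ih, hNN, smul_zero, add_zero,
        Nat.cast_succ, add_smul, one_smul, add_assoc]
  have hgN : ∀ g m, M g (N m) = (lam g : k) • N (M g m) := by
    intro g m
    obtain ⟨n, hn, hl⟩ := hconj g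
    have hgd : g * d = d ^ n * g := by rw [← hn]; group
    rw [hNapply, map_sub, ← Module.End.mul_apply, ← map_mul, hgd, map_mul, Module.End.mul_apply,
      hpow, hl, add_sub_cancel_left]
  obtain ⟨c, hc⟩ := hS.exists_eq_smul_id C fun g v => by
    obtain ⟨m, rfl⟩ := hq v
    have h := hgN g m
    rw [← hC, ← hC, ← i.isIntertwining, twistRep_apply, map_smul, q.isIntertwining] at h
    exact (hi ((smul_right_injective VM (lam g).ne_zero) h)).symm
  refine ⟨c, fun n m => ?_⟩
  rw [hpow, ← hC, hc, map_smul, smul_smul]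

end Extension

/-! ### Twisted forms on `S` and invariant forms on the extension -/

section ExtensionForms

open Representation

variable {k G VS VM : Type*} [Field k] [Group G] [AddCommGroup VS] [Module k VS]
  [AddCommGroup VM] [Module k VM] {lam : G →* kˣ}
  {S : Representation k G VS} {M : Representation k G VM}

/-- An isomorphism `S^* ≅ λS` is a non-degenerate form on `S` with values in `λ⁻¹`. By Schur's lemma
it is symmetric or alternating. -/
theorem exists_twisted_form [IsAlgClosed k] [FiniteDimensional k VS] (hS : S.IsIrreducible)
    (φ : S.dual.Equiv (twistRep lam S)) :
    ∃ (ψ : LinearMap.BilinForm k VS) (δ : ℤ), δ * δ = 1 ∧ (∀ v, (∀ w, ψ v w = 0) → v = 0) ∧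
      (∀ v w, ψ w v = δ * ψ v w) ∧
      ∀ g v w, ψ (S g v) (S g w) = (lam g⁻¹ : k) * ψ v w := by
  let ψ : LinearMap.BilinForm k VS := φ.symm.toLinearMap
  have hφψ : ∀ v, φ (ψ v) = v := fun v => φ.apply_symm_apply v
  have hinj : ∀ v, (∀ w, ψ v w = 0) → v = 0 := fun v hv => by
    rw [← hφψ v, LinearMap.ext (f := ψ v) (g := 0) hv]
    exact map_zero φ.toLinearMap
  have hinv : ∀ g v w, ψ (S g v) (S g w) = (lam g⁻¹ : k) * ψ v w := by
    intro g v w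
    have h := IntertwiningMap.isIntertwining _ _ φ.symm.toIntertwiningMap g v
    have h2 : ψ (twistRep lam S g v) = S.dual g (ψ v) := h
    have h1 : (lam g : k) * ψ (S g v) (S g w) = ψ v w := by
      have h3 := LinearMap.congr_fun h2 (S g w)
      rw [twistRep_apply, map_smul, LinearMap.smul_apply, smul_eq_mul] at h3
      rw [h3]
      change ψ v (S g⁻¹ (S g w)) = _
      rw [← Module.End.mul_apply, ← map_mul, inv_mul_cancel, map_one, Module.End.one_apply]
    rw [← h1, ← mul_assoc, ← Units.val_mul, ← map_mul, inv_mul_cancel, map_one, Units.val_one,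
      one_mul]
  -- the transposed form is `ψ(C v, w)` for an equivariant `C`
  let C : Module.End k VS := φ.toLinearMap ∘ₗ ψ.flip
  have hC : ∀ v w, ψ (C v) w = ψ w v := fun v w => by
    have : ψ (φ (ψ.flip v)) = ψ.flip v := φ.symm_apply_apply _
    exact LinearMap.congr_fun this w
  obtain ⟨c, hc⟩ := hS.exists_eq_smul_id C fun g v => by
    rw [← sub_eq_zero]
    refine hinj _ fun w => ?_
    have hw : S g (S g⁻¹ w) = w := by
      rw [← Module.End.mul_apply, ← map_mul, mul_inv_cancel, map_one, Module.End.one_apply]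
    rw [map_sub, LinearMap.sub_apply, hC, ← hw, hinv, hinv, hC, sub_self]
  have hsign : ∀ v w, ψ w v = c * ψ v w := fun v w => by
    rw [← hC, hc, map_smul, LinearMap.smul_apply, smul_eq_mul]
  have hcc : c * c = 1 := by
    have := hS.nontrivial
    obtain ⟨v, hv⟩ := exists_ne (0 : VS)
    obtain ⟨w, hw⟩ := not_forall.1 fun h => hv (hinj v h)
    refine mul_right_cancel₀ hw ?_
    rw [mul_assoc, ← hsign v w, ← hsign w v, one_mul]
  obtain ⟨δ, hδ, rfl⟩ : ∃ δ : ℤ, δ * δ = 1 ∧ (δ : k) = c := by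
    rcases mul_self_eq_one_iff.1 hcc with h | h
    · exact ⟨1, by norm_num, by rw [h, Int.cast_one]⟩
    · exact ⟨-1, by norm_num, by rw [h, Int.cast_neg, Int.cast_one]⟩
  exact ⟨ψ, δ, hδ, hinj, hsign, hinv⟩

/-- The form on `M` is the average of `(m, m') ↦ ψ(r m, q m') - ψ(q m, r m')`, where `r` is a
linear retraction of the inclusion `i` of the socle. The minus sign makes this form invariant under
`d`, and averaging does not change its values on pairs with an entry in the socle; these values
detect the radical. So the form has the sign opposite to that of `ψ`. -/
theorem exists_invariant_form_of_extension [Finite G] [FiniteDimensional k VM]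
    (h2 : (2 : k) ≠ 0) {b : MonoidAlgebra k G} {D : Subgroup G} (hb : IsRelTraceFrom b D)
    (hMb : BelongsToBlock M b)
    (i : IntertwiningMap (twistRep lam S) M) (q : IntertwiningMap M S)
    (hi : Function.Injective i) (hq : Function.Surjective q) (hex : Function.Exact i q)
    (hD : ∀ x ∈ D, ∃ c : k, ∀ m, M x m = m + c • i (q m))
    {ψ : LinearMap.BilinForm k VS} {δ : ℤ} (hδ : δ * δ = 1)
    (hψ0 : ∀ v, (∀ w, ψ v w = 0) → v = 0)
    (hψt : ∀ v w, ψ w v = δ * ψ v w)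
    (hψinv : ∀ g v w, ψ (S g v) (S g w) = (lam g⁻¹ : k) * ψ v w) :
    ∃ B : LinearMap.BilinForm k VM, B.Nondegenerate ∧ (∀ v w, B w v = -(δ * B v w)) ∧
      ∀ g v w, B (M g v) (M g w) = B v w := by
  obtain ⟨a, ha, rfl⟩ := hb
  have hqi : ∀ v, q (i v) = 0 := fun v => (hex _).2 ⟨v, rfl⟩
  have hδk : (δ : k) * δ = 1 := by exact_mod_cast congrArg (Int.cast (R := k)) hδ
  have hTb : ∀ v, (twistRep lam S).asAlgebraHom (relTrace D a) v = v := fun v => hi <| by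
    rw [i.apply_asAlgebraHom, hMb, Module.End.one_apply]
  obtain ⟨r, hr⟩ := i.toLinearMap.exists_leftInverse_of_injective (LinearMap.ker_eq_bot.2 hi)
  have hr' : ∀ v, r (i v) = v := fun v => LinearMap.congr_fun hr v
  have hTψ : ∀ g v w, ψ (twistRep lam S g v) w = ψ v (S g⁻¹ w) := by
    intro g v w
    have hw : S g (S g⁻¹ w) = w := by
      rw [← Module.End.mul_apply, ← map_mul, mul_inv_cancel, map_one, Module.End.one_apply]
    conv_lhs => rw [← hw]
    rw [twistRep_apply, map_smul, LinearMap.smul_apply, hψinv, smul_eq_mul, ← mul_assoc,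
      ← Units.val_mul, ← map_mul, mul_inv_cancel, map_one, Units.val_one, one_mul]
  have hψT : ∀ g v w, ψ (S g v) w = ψ v (twistRep lam S g⁻¹ w) := by
    intro g v w
    have h := hTψ g⁻¹ w v
    rw [inv_inv] at h
    rw [hψt w, hψt _ v, h]
  let f : VM →ₗ[k] Module.Dual k VM :=
    ψ.compl₁₂ r q.toLinearMap - ψ.compl₁₂ q.toLinearMap r
  have hf : ∀ m m', f m m' = ψ (r m) (q m') - ψ (q m) (r m') := fun m m' => rfl
  have hfi : ∀ v m, f (i v) m = ψ v (q m) := fun v m => by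
    rw [hf, hr', hqi, map_zero, LinearMap.zero_apply, sub_zero]
  have hif : ∀ m v, f m (i v) = -ψ (q m) v := fun m v => by
    rw [hf, hr', hqi, map_zero, zero_sub]
  -- invariance under the defect group
  have hfD : ∀ x ∈ D, ∀ m, f (M x m) = M.dual x (f m) := by
    have hinv : ∀ x ∈ D, ∀ m m', f (M x m) (M x m') = f m m' := by
      intro x hx m m'
      obtain ⟨c, hc⟩ := hD x hx
      rw [hc, hc, map_add, map_add, LinearMap.add_apply, LinearMap.add_apply, map_smul, map_smul,
        map_smul, LinearMap.smul_apply, hfi, hif, LinearMap.smul_apply, hfi, hqi]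
      simp
    intro x hx m
    refine LinearMap.ext fun m' => ?_
    have hm' : M x (M x⁻¹ m') = m' := by
      rw [← Module.End.mul_apply, ← map_mul, mul_inv_cancel, map_one, Module.End.one_apply]
    conv_lhs => rw [← hm']
    rw [hinv x hx]
    rfl
  -- `f ∘ i` and the composition of `f` with the restriction to the socle are already `G`-equivariant
  let j : IntertwiningMap (twistRep lam S) M.dual :=
    (ψ.compl₂ q.toLinearMap).intertwiningMap_of_isIntertwiningMap _ _ fun g v =>
      LinearMap.ext fun m => by
        change ψ (twistRep lam S g v) (q m) = ψ v (q (M g⁻¹ m))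
        rw [hTψ, q.isIntertwining]
  let res : IntertwiningMap M.dual (twistRep lam S).dual :=
    (i.toLinearMap.dualMap).intertwiningMap_of_isIntertwiningMap _ _ fun g ξ =>
      LinearMap.ext fun v => by
        change ξ (M g⁻¹ (i v)) = ξ (i (twistRep lam S g⁻¹ v))
        rw [i.isIntertwining]
  let t : IntertwiningMap M (twistRep lam S).dual :=
    (-(ψ ∘ₗ q.toLinearMap)).intertwiningMap_of_isIntertwiningMap _ _ fun g m =>
      LinearMap.ext fun v => by
        change -ψ (q (M g m)) v = -ψ (q m) (twistRep lam S g⁻¹ v)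
        rw [q.isIntertwining, hψT]
  let F : LinearMap.BilinForm k VM := relAverage D a M M.dual f
  have hF1 : ∀ v m, F (i v) m = ψ v (q m) := by
    intro v m
    have h := relAverage_comp (D := D) (a := a) (f := f) i j
      (fun v => LinearMap.ext fun m => hfi v m) v
    rw [hTb] at h
    exact LinearMap.congr_fun h m
  have hF2 : ∀ m v, F m (i v) = -ψ (q m) v := by
    intro m v
    have h := comp_relAverage (D := D) (a := a) (f := f) res t
      (fun m => LinearMap.ext fun v => hif m v) m
    rw [hMb, Module.End.one_apply] at h
    exact LinearMap.congr_fun h v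
  have hFinv : ∀ g v w, F (M g v) (M g w) = F v w := by
    intro g v w
    have h := LinearMap.congr_fun (relAverage_isIntertwining ha hfD g v) (M g w)
    refine h.trans ?_
    change F v (M g⁻¹ (M g w)) = F v w
    rw [← Module.End.mul_apply, ← map_mul, inv_mul_cancel, map_one, Module.End.one_apply]
  -- the part of `F` of sign `-δ`; on pairs with an entry in the socle it is `2F`
  let B : LinearMap.BilinForm k VM := F - (δ : k) • F.flip
  have hB : ∀ v w, B v w = F v w - δ * F w v := fun v w => rfl
  have hBt : ∀ v w, B w v = -(δ * B v w) := fun v w => by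
    rw [hB, hB]
    linear_combination (-F w v) * hδk
  have hB1 : ∀ v m, B (i v) m = 2 * ψ v (q m) := fun v m => by
    rw [hB, hF1, hF2, hψt v]
    linear_combination (ψ v (q m)) * hδk
  have hleft : ∀ m, (∀ m', B m m' = 0) → m = 0 := by
    intro m hm
    have hqm : q m = 0 := by
      refine hψ0 _ fun w => ?_
      have h := hBt m (i w)
      rw [hm, hB1, mul_zero, neg_zero, mul_eq_zero] at h
      rw [hψt w, h.resolve_left h2, mul_zero]
    obtain ⟨v, rfl⟩ := (hex m).1 hqm
    have hv : v = 0 := by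
      refine hψ0 _ fun w => ?_
      obtain ⟨m', rfl⟩ := hq w
      have h := hm m'
      rw [hB1, mul_eq_zero] at h
      exact h.resolve_left h2
    rw [hv, map_zero]
  refine ⟨B, ⟨fun m hm => hleft m hm, fun m hm => hleft m fun m' => ?_⟩, hBt, fun g v w => ?_⟩
  · rw [hBt m', hm, mul_zero, neg_zero]
  · rw [hB, hB, hFinv, hFinv]

/-- A uniserial extension of a module in a block belongs to that block. -/
theorem belongsToBlock_of_isUniserial {b : MonoidAlgebra k G} (hb : IsBlockIdempotent b)
    (hS : S.IsIrreducible) (hSb : BelongsToBlock S b) (hM : IsUniserialRep M)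
    (q : IntertwiningMap M S) (hq : Function.Surjective q) : BelongsToBlock M b := by
  obtain ⟨hcenter, hidem, -⟩ := hb
  set e := M.asAlgebraHom b with he
  have hee : ∀ m, e (e m) = e m := fun m => by
    rw [← Module.End.mul_apply, he, ← map_mul, hidem]
  have hcomm : ∀ g m, e (M g m) = M g (e m) := fun g m => by
    have h := Subalgebra.mem_center_iff.1 hcenter (MonoidAlgebra.of k G g)
    have h' := congrArg M.asAlgebraHom h
    rw [map_mul, map_mul, asAlgebraHom_of] at h'
    exact (LinearMap.congr_fun h' m).symm
  let E : IntertwiningMap M M := e.intertwiningMap_of_isIntertwiningMap _ _ hcomm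
  have hqe : ∀ m, q (e m) = q m := fun m => by
    rw [he, q.apply_asAlgebraHom, hSb, Module.End.one_apply]
  have := hS.nontrivial
  rcases hM E.range E.ker with h | h
  · obtain ⟨s, hs⟩ := exists_ne (0 : VS)
    obtain ⟨m, rfl⟩ := hq s
    have h0 : e (e m) = 0 := h (show e m ∈ E.range from ⟨m, rfl⟩)
    rw [hee] at h0
    exact absurd (by rw [← hqe, h0, map_zero]) hs
  · refine LinearMap.ext fun m => ?_
    have hker : m - e m ∈ E.ker := by
      change e (m - e m) = 0
      rw [map_sub, hee, sub_self]
    obtain ⟨m', hm'⟩ := h hker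
    have hm'' : e m' = m - e m := hm'
    have h0 : e (m - e m) = 0 := hker
    rw [← hm'', hee, hm'', sub_eq_zero] at h0
    exact h0.symm

theorem isIndecomposableRep_of_isUniserialRep [Nontrivial VM] (hM : IsUniserialRep M) :
    IsIndecomposableRep M := by
  refine ⟨inferInstance, fun X Y hXY => ?_⟩
  rcases hM X Y with h | h
  · exact Or.inl (le_bot_iff.1 (hXY.disjoint le_rfl h))
  · exact Or.inr (le_bot_iff.1 (hXY.disjoint h le_rfl))

theorem isSelfDual_of_form [FiniteDimensional k VM] {B : LinearMap.BilinForm k VM}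
    (hB : B.Nondegenerate) (hinv : ∀ g v w, B (M g v) (M g w) = B v w) : IsSelfDual M := by
  let β : IntertwiningMap M M.dual :=
    LinearMap.intertwiningMap_of_isIntertwiningMap M M.dual B fun g v => LinearMap.ext fun w => by
      change B (M g v) w = B v (M g⁻¹ w)
      have hw : M g (M g⁻¹ w) = w := by
        rw [← Module.End.mul_apply, ← map_mul, mul_inv_cancel, map_one, Module.End.one_apply]
      conv_lhs => rw [← hw]
      exact hinv g v _
  exact ⟨β.ofBijective (B.toDual hB).bijective⟩

theorem isOrthogonalType_of_form (h2 : (2 : k) ≠ 0) {B : LinearMap.BilinForm k VM}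
    (hB : B.Nondegenerate) (hsymm : ∀ v w, B w v = B v w)
    (hinv : ∀ g v w, B (M g v) (M g w) = B v w) : IsOrthogonalType M := by
  have : Invertible (2 : k) := invertibleOfNonzero h2
  refine ⟨LinearMap.BilinMap.toQuadraticMap B, ?_, fun g v => hinv g v v⟩
  rw [← QuadraticMap.nondegenerate_associated_iff,
    QuadraticMap.associated_left_inverse k fun v w => hsymm w v]
  exact hB

theorem isSymplecticType_of_form (h2 : (2 : k) ≠ 0) {B : LinearMap.BilinForm k VM}
    (hB : B.Nondegenerate) (hskew : ∀ v w, B w v = -B v w)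
    (hinv : ∀ g v w, B (M g v) (M g w) = B v w) : IsSymplecticType M := by
  refine ⟨B, hB, fun v => ?_, hinv⟩
  have h : 2 * B v v = 0 := by linear_combination hskew v v
  exact (mul_eq_zero.1 h).resolve_left h2

end ExtensionForms

/-! ### The type of the extension -/

theorem mainTheorem10 {k G VS VM : Type*} [Field k] [IsAlgClosed k]
    (p : ℕ) [Fact p.Prime] (hp2 : p ≠ 2) [CharP k p]
    [Group G] [Fintype G]
    -- a block of `kG` with a cyclic normal defect group `D` of order `p ^ a`, `a ≥ 1`
    (b : MonoidAlgebra k G) (hb : IsBlockIdempotent b)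
    (D : Subgroup G) (hD : IsDefectGroup b D) [D.Normal] [IsCyclic D]
    (a : ℕ) (ha : 1 ≤ a) (hcard : Nat.card D = p ^ a)
    -- an element `u` of order `p` in `D`, defining the linear character `λ`
    (u : G) (huD : u ∈ D) (hu : orderOf u = p)
    -- an irreducible module `S` in the block with `S^* ≅ λS`
    [AddCommGroup VS] [Module k VS] [FiniteDimensional k VS]
    (S : Representation k G VS) (hS : S.IsIrreducible) (hSb : BelongsToBlock S b)
    (hdual : Nonempty (S.dual.Equiv (twistRep (actionCharacter k p D u huD hu) S)))
    -- the uniserial module `M` with head `S` and socle `λS`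
    [AddCommGroup VM] [Module k VM] [FiniteDimensional k VM]
    (M : Representation k G VM)
    (hM : IsUniserialOfHeadSocle M S (twistRep (actionCharacter k p D u huD hu) S))
    -- ordinary characters lifting the Brauer characters of `S` and `λ`
    (θ : CommGroup.torsion kˣ →* ℂˣ) (hθ : Function.Injective θ)
    (χ μ : G → ℂ) (hχ : IsIrreducibleCharacter χ) (hμ : IsIrreducibleCharacter μ)
    (hχS : LiftsBrauer p χ (brauerCharacter θ S))
    (hμl : LiftsBrauer p μ (brauerCharacter θ (linearRep (actionCharacter k p D u huD hu)))) :
    BelongsToBlock M b ∧ IsIndecomposableRep M ∧ IsSelfDual M ∧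
      (twistedIndicator μ χ = -1 → IsOrthogonalType M) ∧
      (twistedIndicator μ χ = 1 → IsSymplecticType M) := by
  set lam := actionCharacter k p D u huD hu with hlam
  obtain ⟨i, q, hi, hq, hex⟩ := hM.exact_seq
  have hMb := belongsToBlock_of_isUniserial hb hS hSb hM.uniserial q hq
  have := hS.nontrivial
  have : Nontrivial VM := hq.nontrivial
  have h2 : (2 : k) ≠ 0 := Ring.two_ne_zero (ringChar.eq k p ▸ hp2)
  -- a generator of the defect group
  obtain ⟨⟨d, hdD⟩, hgen⟩ := IsCyclic.exists_generator (α := D)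
  have hd : ∀ x ∈ D, x ∈ Subgroup.zpowers d := fun x hx => by
    obtain ⟨z, hz⟩ := Subgroup.mem_zpowers_iff.1 (hgen ⟨x, hx⟩)
    exact Subgroup.mem_zpowers_iff.2 ⟨z, by simpa using congrArg Subtype.val hz⟩
  have hda : d ^ p ^ a = 1 := by
    rw [← hcard]
    exact congrArg Subtype.val (pow_card_eq_one' (x := (⟨d, hdD⟩ : D)))
  have hSD : ∀ x ∈ D, S x = 1 := fun x hx => hS.apply_eq_one_of_mem p D hd hdD hda hx
  have hconj : ∀ g, ∃ n : ℕ, g * d * g⁻¹ = d ^ n ∧ (lam g : k) = n := fun g => by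
    obtain ⟨n, hn⟩ := exists_conj_eq_pow D hdD g
    refine ⟨n, hn, actionCharacter_eq k p D u huD hu g n ?_⟩
    obtain ⟨z, rfl⟩ := Subgroup.mem_zpowers_iff.1 (hd u huD)
    rw [← conj_zpow, hn, ← zpow_natCast, ← zpow_natCast, ← zpow_mul, ← zpow_mul, mul_comm]
  have hlD : ∀ x ∈ D, lam x = 1 := fun x hx => Units.ext <| by
    rw [hlam, actionCharacter_eq k p D u huD hu x 1, Nat.cast_one, Units.val_one]
    obtain ⟨y, rfl⟩ := Subgroup.mem_zpowers_iff.1 (hd x hx)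
    obtain ⟨z, rfl⟩ := Subgroup.mem_zpowers_iff.1 (hd u huD)
    rw [← zpow_add, add_comm, zpow_add, mul_inv_cancel_right, pow_one]
  have hMD : ∀ x ∈ D, ∃ c : k, ∀ m, M x m = m + c • i (q m) := fun x hx => by
    obtain ⟨c, hc⟩ := exists_apply_generator_pow_eq hS i q hi hq hex (hSD d hdD) (hlD d hdD) hconj
    obtain ⟨n, rfl⟩ := mem_powers_iff_mem_zpowers.2 (hd x hx)
    exact ⟨n * c, hc n⟩
  obtain ⟨φ⟩ := hdual
  obtain ⟨ψ, δ, hδ, hψ0, hψt, hψinv⟩ := exists_twisted_form hS φ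
  obtain ⟨B, hB, hBt, hBinv⟩ := exists_invariant_form_of_extension h2 hD.1 hMb i q hi hq hex hMD hδ
    hψ0 hψt hψinv
  have hψne : ψ ≠ 0 := by
    rintro rfl
    obtain ⟨v, hv⟩ := exists_ne (0 : VS)
    exact hv (hψ0 v fun w => rfl)
  have hsign : ∀ ε : ℤ, ε * ε = 1 → twistedIndicator μ χ = ε → δ ≠ -ε := fun ε hε hind =>
    sign_ne_neg_twistedIndicator p hp2 S hS lam θ hθ hχ hμ hχS hμl hε hind hψne hψt hψinv
  have hδ1 : δ = 1 ∨ δ = -1 := mul_self_eq_one_iff.1 hδ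
  refine ⟨hMb, isIndecomposableRep_of_isUniserialRep hM.uniserial, isSelfDual_of_form hB hBinv,
    fun h => ?_, fun h => ?_⟩
  · have hne := hsign (-1) (by norm_num) (by rw [h]; norm_num)
    obtain rfl : δ = -1 := hδ1.resolve_left (by simpa using hne)
    exact isOrthogonalType_of_form h2 hB (fun v w => by rw [hBt v w]; simp) hBinv
  · have hne := hsign 1 (by norm_num) (by rw [h]; norm_num)
    obtain rfl : δ = 1 := hδ1.resolve_right hne
    exact isSymplecticType_of_form h2 hB (fun v w => by rw [hBt v w]; simp) hBinv
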